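/- **Setting.** A *delay density* is a measurable $f:\mathbb R\to\mathbb R_{\ge 0}$ with $f(t)=0$ for $t<0$ and $\int_0^\infty f(t)\,dt=1$ for which there is an interval $I$, of the form $[\ell,u]$ with $\ell<u$ in $\mathbb N_0$ or $[\ell,\infty)$ with $\ell\in\mathbb N_0$, such that $f=0$ outside $I$ and $f$ is bounded below by a positive constant on every compact interval $[a,b]\subseteq I$. A *semi-Markov process* $\mathcal M=(S,\mathbf P,\mathbf D,\alpha_0)$ consists of a finite set $S$, a probability distribution $\mathbf P(s)$ on $S$ for each $s\in S$, a delay density $\mathbf D(s,s')$ for all $s,s'\in S$, and an initial distribution $\alpha_0$ on $S$; here $\alpha_0$ assigns $1$ to a fixed state $s_0$. Its runs are the sequences $s_0\,t_0\,s_1\,t_1\cdots$ with $s_i\in S$, $t_i\in\mathbb R_{\ge0}$, and $\mathcal P_{\mathcal M}$ is the probability measure on runs under which, in state $s_i$, the next state $s_{i+1}$ is chosen by $\mathbf P(s_i)$ and then the delay $t_i$ has density $\mathbf D(s_i,s_{i+1})$. Let $\mathcal A$ be a deterministic timed automaton with finite sets of locations $Q$ and clocks $\mathcal X$, alphabet $S$,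 initial location $q_0$, and finitely many edges $(q,s,g,X,q')$, where the guard $g$ is a finite conjunction of constraints $x\bowtie k$ with $x\in\mathcal X$, ${\bowtie}\in\{<,\le,>,\ge\}$, $k\in\mathbb N_0$, and $X\subseteq\mathcal X$ is a set of clocks to be reset. Guards are deterministic (two edges with the same $q$ and $s$ whose guards are satisfied by a common valuation have equal guards, as sets of valuations, equal reset sets and equal targets) and total (for all $q$, $s$ and every valuation $\nu:\mathcal X\to\mathbb R_{\ge0}$ some edge from $q$ with letter $s$ has its guard satisfied by $\nu$). Let $B_{\max}$ be the largest constant in the guards ($0$ if there is none). The *product process* is the Markov chain on $\Gamma=S\times Q\times\mathbb R_{\ge0}^{\mathcal X}$ started in $z_0=(s_0,q_0,\vec 0)$ in which one step from $z=(s,q,\nu)$ goes to $(s',\bar q,\bar\nu+t)$, where $(\bar q,\bar\nu)$ is the configuration that $\mathcal A$ enters from $(q,\nu)$ on reading $s$ (taking the enabled edge and resetting its clocks), $s'$ is drawn from $\mathbf P(s)$, and $t$ has density $\mathbf D(s,s')$. Let $P(z,\cdot)$ be its transition kernel and $P^i$ the $i$-step kernel. Every run $s_0\,t_0\,s_1\,t_1\cdots$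 of $\mathcal M$ determines a run $(s_0,q_0,\nu_0)(s_1,q_1,\nu_1)\cdots$ of the product, with $\nu_0=\vec0$, $\nu_{i+1}=\bar\nu_i+t_i$, and $(q_{i+1},\bar\nu_i)$ the configuration entered from $(q_i,\nu_i)$ on reading $s_i$. A clock $x$ is *relevant* for $\nu$ if $\nu(x)\le B_{\max}$. Two states $(s_1,q_1,\nu_1)$, $(s_2,q_2,\nu_2)$ are in the same *region* if $s_1=s_2$, $q_1=q_2$, the same clocks are relevant for $\nu_1$ and $\nu_2$, for each relevant $x$ the numbers $\nu_1(x),\nu_2(x)$ have the same integral part and are both or neither integers, and for all relevant $x,y$ the fractional parts satisfy $\mathrm{frac}(\nu_1(x))\le\mathrm{frac}(\nu_1(y))$ iff $\mathrm{frac}(\nu_2(x))\le\mathrm{frac}(\nu_2(y))$. The *region graph* $(V,E)$ has as vertices the regions $R$ with $P^n(z_0,R)>0$ for some $n\ge0$, and $(R,R')\in E$ iff $P(z,R')>0$ for some $z\in R$. A *bottom strongly connected component* (BSCC) is a nonempty strongly connected set of vertices that no edge leaves; it is identified with the union of its regions where it stands for a set of states. Let $p_{\min}$ be the smallest positive transition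 probability $\mathbf P(s)(s')$ of $\mathcal M$, and let $c_{\mathfrak D}>0$ be any number such that, for every $f=\mathbf D(s,s')$ with $s,s'\in S$: for all $x\in[0,B_{\max}]$ either $f(x)>c_{\mathfrak D}$ or $f(x)=0$, and $\int_{B_{\max}}^\infty f(x)\,dx$ is either larger than $c_{\mathfrak D}$ or equal to $0$. **Theorem.** Let $\mathcal C$ be a BSCC of the region graph, and let $\mathcal R$ be the set of runs of $\mathcal M$ whose run of the product process visits $\mathcal C$. Then for every $i\in\mathbb N_0$ $$\mathcal P_{\mathcal M}(\mathcal R)-P^i(z_0,\mathcal C)\ \le\ \left(1-\left(\frac{p_{\min}\cdot c_{\mathfrak D}}{c}\right)^{c}\right)^{\lfloor i/c\rfloor},\qquad c=4\cdot|V|.$$ -/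

import Mathlib

open MeasureTheory ProbabilityTheory
open scoped ENNReal NNReal

/-! ### Semi-Markov processes -/

/-- Delay densities: probability densities on `[0, ∞)`, vanishing outside an interval `I` which is
`[l, u]` or `[l, ∞)` with natural end points, and bounded away from `0` on every compact
subinterval of `I`. -/
def IsDelayDensity (f : ℝ → ℝ≥0) : Prop :=
  Measurable f ∧ (∀ t < 0, f t = 0) ∧ ∫⁻ t in Set.Ici (0 : ℝ), (f t : ℝ≥0∞) = 1 ∧
    ∃ I : Set ℝ,
      ((∃ l u : ℕ, l < u ∧ I = Set.Icc (l : ℝ) u) ∨ ∃ l : ℕ, I = Set.Ici (l : ℝ)) ∧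
      (∀ t ∉ I, f t = 0) ∧
      ∀ c d : ℝ, Set.Icc c d ⊆ I → ∃ b : ℝ≥0, 0 < b ∧ ∀ t ∈ Set.Icc c d, b ≤ f t

/-- A semi-Markov process with state set `S`. -/
structure SMP (S : Type*) where
  /-- the transition probability function -/
  trans : S → PMF S
  /-- the delay function -/
  delay : S → S → ℝ → ℝ≥0
  isDelayDensity_delay : ∀ s s', IsDelayDensity (delay s s')
  /-- the initial distribution -/
  init : PMF S

/-- The distribution on `ℝ≥0` with density `f`. -/
noncomputable def delayMeasure (f : ℝ → ℝ≥0) : Measure ℝ≥0 :=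
  (volume.withDensity fun t : ℝ => (f t : ℝ≥0∞)).map Real.toNNReal

theorem IsDelayDensity.isProbabilityMeasure {f : ℝ → ℝ≥0} (hf : IsDelayDensity f) :
    IsProbabilityMeasure (delayMeasure f) := by
  obtain ⟨-, hneg, hint, -⟩ := hf
  refine ⟨?_⟩
  rw [delayMeasure, Measure.map_apply (by fun_prop) MeasurableSet.univ, Set.preimage_univ,
    withDensity_apply _ MeasurableSet.univ, setLIntegral_univ, ← hint]
  refine (setLIntegral_eq_of_support_subset ?_).symm
  intro t ht
  by_contra h
  exact ht (by simp [hneg t (not_le.1 h)])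

namespace SMP

variable {S : Type*} [Fintype S] [MeasurableSpace S] [DiscreteMeasurableSpace S]

/-- One step of the semi-Markov process from the state `s`: the next state `s'` is drawn from
`trans s`, then the delay is drawn from the density `delay s s'`. -/
noncomputable def stepKernel (M : SMP S) : Kernel S (S × ℝ≥0) where
  toFun s := ∑ s' : S, M.trans s s' • (delayMeasure (M.delay s s')).map (Prod.mk s')
  measurable' := Measurable.of_discrete

instance (M : SMP S) : IsMarkovKernel M.stepKernel := by
  refine ⟨fun s => ⟨?_⟩⟩
  change (∑ s' : S, M.trans s s' • (delayMeasure (M.delay s s')).map (Prod.mk s')) Set.univ = 1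
  have h (s' : S) : (delayMeasure (M.delay s s')).map (Prod.mk s') Set.univ = 1 := by
    have := (M.isDelayDensity_delay s s').isProbabilityMeasure
    rw [Measure.map_apply (by fun_prop) MeasurableSet.univ, Set.preimage_univ, measure_univ]
  simp only [Measure.finsetSum_apply, Measure.smul_apply, h, smul_eq_mul, mul_one]
  rw [← tsum_fintype (L := .unconditional S), (M.trans s).tsum_coe]

/-- The law of the sequence `(s₀, 0), (s₁, t₀), (s₂, t₁), …`, where `s₀ t₀ s₁ t₁ ⋯` is a random run
of the semi-Markov process (Ionescu-Tulcea construction). -/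
noncomputable def jumpMeasure (M : SMP S) : Measure (ℕ → S × ℝ≥0) :=
  (M.init.toMeasure.map fun s (_ : Finset.Iic 0) => (s, (0 : ℝ≥0))).bind
    (Kernel.traj (X := fun _ => S × ℝ≥0)
      (fun n => M.stepKernel.comap (fun h => (h ⟨n, Finset.mem_Iic.2 le_rfl⟩).1) (by fun_prop)) 0)

/-- The probability measure on runs. A run `s₀ t₀ s₁ t₁ ⋯` is encoded by the
sequence `n ↦ (sₙ, tₙ)`. -/
noncomputable def runMeasure (M : SMP S) : Measure (ℕ → S × ℝ≥0) :=
  M.jumpMeasure.map fun y n => ((y n).1, (y (n + 1)).2)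

/-- The smallest (positive) transition probability. -/
noncomputable def pMin (M : SMP S) : ℝ :=
  sInf {p : ℝ | ∃ s s' : S, 0 < M.trans s s' ∧ p = (M.trans s s').toReal}

/-- `cδ` is a positive bound such that every delay density takes on `[0, B]` only values
that are `0` or larger than `cδ`, and gives to `[B, ∞)` a mass that is `0` or larger than `cδ`. -/
def IsDelayBound (M : SMP S) (B : ℕ) (cδ : ℝ) : Prop :=
  0 < cδ ∧ ∀ s s' : S,
    (∀ x ∈ Set.Icc (0 : ℝ) B, cδ < M.delay s s' x ∨ M.delay s s' x = 0) ∧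
    (ENNReal.ofReal cδ < ∫⁻ x in Set.Ici (B : ℝ), (M.delay s s' x : ℝ≥0∞) ∨
      ∫⁻ x in Set.Ici (B : ℝ), (M.delay s s' x : ℝ≥0∞) = 0)

end SMP

/-! ### Deterministic timed automata -/

/-- Clock valuations. -/
abbrev ClockVal (X : Type*) := X → ℝ≥0

open Classical in
/-- The valuation `ν[Y := 0]`. -/
noncomputable def ClockVal.reset {X : Type*} (ν : ClockVal X) (Y : Set X) : ClockVal X :=
  fun x => if x ∈ Y then 0 else ν x

/-- The valuation `ν + t`. -/
noncomputable def ClockVal.delay {X : Type*} (ν : ClockVal X) (t : ℝ≥0) : ClockVal X :=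
  fun x => ν x + t

/-- The comparisons `<`, `≤`, `>`, `≥`. -/
inductive ClockCmp
  | lt
  | le
  | gt
  | ge

/-- Basic constraints `x ⋈ c`. -/
structure ClockConstraint (X : Type*) where
  clock : X
  cmp : ClockCmp
  bound : ℕ

/-- Satisfaction of a basic constraint. -/
def ClockConstraint.Sat {X : Type*} (b : ClockConstraint X) (ν : ClockVal X) : Prop :=
  match b.cmp with
  | .lt => ν b.clock < b.bound
  | .le => ν b.clock ≤ b.bound
  | .gt => ν b.clock > b.bound
  | .ge => ν b.clock ≥ b.bound

/-- Guards: finite conjunctions of basic constraints. -/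
abbrev ClockGuard (X : Type*) := Finset (ClockConstraint X)

/-- Satisfaction of a guard. -/
def ClockGuard.Sat {X : Type*} (g : ClockGuard X) (ν : ClockVal X) : Prop :=
  ∀ b ∈ g, b.Sat ν

/-- Edges of a timed automaton. -/
structure DTAEdge (Q A X : Type*) where
  src : Q
  letter : A
  guard : ClockGuard X
  reset : Set X
  tgt : Q

/-- A deterministic timed automaton with locations `Q`, alphabet `A` and clocks `X`. -/
structure DTA (Q A X : Type*) where
  edges : Finset (DTAEdge Q A X)
  init : Q
  deterministic : ∀ e ∈ edges, ∀ e' ∈ edges, e.src = e'.src → e.letter = e'.letter →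
    (∃ ν, e.guard.Sat ν ∧ e'.guard.Sat ν) →
    {ν | e.guard.Sat ν} = {ν | e'.guard.Sat ν} ∧ e.reset = e'.reset ∧ e.tgt = e'.tgt
  total : ∀ q a ν, ∃ e ∈ edges, e.src = q ∧ e.letter = a ∧ e.guard.Sat ν

namespace DTA

variable {Q A X : Type*}

/-- The configuration entered from the configuration `(q, ν)` after reading the letter `a`. -/
noncomputable def step (T : DTA Q A X) (q : Q) (ν : ClockVal X) (a : A) : Q × ClockVal X :=
  let e := (T.total q a ν).choose
  (e.tgt, ν.reset e.reset)

theorem step_eq (T : DTA Q A X) {e : DTAEdge Q A X} (he : e ∈ T.edges) {ν : ClockVal X}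
    (hν : e.guard.Sat ν) : T.step e.src ν e.letter = (e.tgt, ν.reset e.reset) := by
  obtain ⟨h1, h2, h3, h4⟩ := (T.total e.src e.letter ν).choose_spec
  obtain ⟨-, h5, h6⟩ := T.deterministic _ h1 e he h2 h3 ⟨ν, h4, hν⟩
  simp only [step, h5, h6]

/-- The maximal constant that appears in the guards (`0` if there is none). -/
def bMax (T : DTA Q A X) : ℕ :=
  T.edges.sup fun e => e.guard.sup fun b => b.bound

end DTA

theorem ClockGuard.measurableSet_sat {X : Type*} [Finite X] (g : ClockGuard X) :
    MeasurableSet {ν : ClockVal X | g.Sat ν} := by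
  have : {ν : ClockVal X | g.Sat ν} = ⋂ b ∈ g, {ν | b.Sat ν} := by
    ext ν; simp [ClockGuard.Sat]
  rw [this]
  refine Finset.measurableSet_biInter _ fun b _ => ?_
  have hb : Measurable fun ν : ClockVal X => ν b.clock := measurable_pi_apply _
  rcases b with ⟨x, _ | _ | _ | _, c⟩
  · exact measurableSet_lt hb measurable_const
  · exact measurableSet_le hb measurable_const
  · exact measurableSet_lt measurable_const hb
  · exact measurableSet_le measurable_const hb

theorem ClockVal.measurable_reset {X : Type*} (Y : Set X) :
    Measurable fun ν : ClockVal X => ν.reset Y := by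
  refine measurable_pi_lambda _ fun x => ?_
  by_cases h : x ∈ Y
  · simp [ClockVal.reset, h]
  · simpa [ClockVal.reset, h] using measurable_pi_apply x

/-! ### The product process -/

/-- States of the product process. -/
abbrev ProdState (S Q X : Type*) := S × Q × ClockVal X

namespace DTA

variable {S Q X : Type*}

/-- The successor of the state `z = (s, q, ν)` of the product process when the
semi-Markov process moves to `p.1` after the delay `p.2`. -/
noncomputable def move (T : DTA Q S X) (z : ProdState S Q X) (p : S × ℝ≥0) : ProdState S Q X :=
  let c := T.step z.2.1 z.2.2 z.1
  (p.1, c.1, c.2.delay p.2)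

/-- The run of the product process that corresponds to a run `σ` of the semi-Markov process. -/
noncomputable def prodRun (T : DTA Q S X) (σ : ℕ → S × ℝ≥0) : ℕ → ProdState S Q X
  | 0 => ((σ 0).1, T.init, 0)
  | n + 1 => T.move (T.prodRun σ n) ((σ (n + 1)).1, (σ n).2)

theorem measurable_step [MeasurableSpace Q] [Finite X] (T : DTA Q S X) (q : Q) (s : S) :
    Measurable fun ν : ClockVal X => T.step q ν s := by
  intro B hB
  have : (fun ν : ClockVal X => T.step q ν s) ⁻¹' B =
      ⋃ e ∈ {e ∈ (T.edges : Set (DTAEdge Q S X)) | e.src = q ∧ e.letter = s},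
        {ν | e.guard.Sat ν} ∩ {ν | (e.tgt, ν.reset e.reset) ∈ B} := by
    ext ν
    simp only [Set.mem_preimage, Set.mem_iUnion, Set.mem_ofPred_eq, Set.mem_inter_iff]
    constructor
    · intro h
      obtain ⟨e, he, rfl, rfl, hν⟩ := T.total q s ν
      exact ⟨e, ⟨he, rfl, rfl⟩, hν, by rwa [T.step_eq he hν] at h⟩
    · rintro ⟨e, ⟨he, rfl, rfl⟩, hν, h⟩
      rwa [T.step_eq he hν]
  rw [this]
  refine MeasurableSet.biUnion (T.edges.finite_toSet.subset fun e he => he.1).countable ?_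
  intro e _
  exact e.guard.measurableSet_sat.inter
    ((measurable_const.prodMk (ClockVal.measurable_reset e.reset)) hB)

theorem measurable_move [Finite S] [MeasurableSpace S] [DiscreteMeasurableSpace S]
    [Finite Q] [MeasurableSpace Q] [DiscreteMeasurableSpace Q] [Finite X] (T : DTA Q S X) :
    Measurable fun p : ProdState S Q X × (S × ℝ≥0) => T.move p.1 p.2 := by
  have h1 : Measurable fun z : ProdState S Q X => T.step z.2.1 z.2.2 z.1 :=
    measurable_from_prod_countable_right fun s =>
      measurable_from_prod_countable_right fun q => T.measurable_step q s
  have h2 : Measurable fun p : ProdState S Q X × (S × ℝ≥0) => T.step p.1.2.1 p.1.2.2 p.1.1 :=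
    h1.comp measurable_fst
  unfold move ClockVal.delay
  fun_prop

end DTA

namespace SMP

variable {S Q X : Type*} [Fintype S] [MeasurableSpace S] [DiscreteMeasurableSpace S]
  [Finite Q] [MeasurableSpace Q] [DiscreteMeasurableSpace Q] [Finite X]

/-- The transition kernel of the product process. Its `n`-step transition kernel
is `M.prodKernel T ^ n`, the power being taken for the composition of kernels. -/
noncomputable def prodKernel (M : SMP S) (T : DTA Q S X) :
    Kernel (ProdState S Q X) (ProdState S Q X) :=
  (Kernel.id ×ₖ M.stepKernel.comap Prod.fst measurable_fst).map fun p => T.move p.1 p.2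

theorem prodKernel_apply (M : SMP S) (T : DTA Q S X) (z : ProdState S Q X) :
    M.prodKernel T z = (M.stepKernel z.1).map (T.move z) := by
  rw [prodKernel, Kernel.map_apply _ T.measurable_move, Kernel.prod_apply, Kernel.id_apply,
    Kernel.comap_apply, Measure.dirac_prod, Measure.map_map T.measurable_move (by fun_prop)]
  rfl

instance (M : SMP S) (T : DTA Q S X) : IsMarkovKernel (M.prodKernel T) :=
  Kernel.IsMarkovKernel.map _ T.measurable_move

/-- The initial probability measure of the product process. -/
noncomputable def prodInit (M : SMP S) (T : DTA Q S X) : Measure (ProdState S Q X) :=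
  M.init.toMeasure.map fun s => (s, T.init, 0)

end SMP

/-! ### Regions and the region graph -/

/-- `a` and `b` have the same integral part, and both or neither of them are integers. -/
def AgreeOnIntegralPart (a b : ℝ) : Prop :=
  ⌊a⌋ = ⌊b⌋ ∧ (Int.fract a = 0 ↔ Int.fract b = 0)

/-- The region relation for the maximal constant `B`. -/
structure RegionRel {S Q X : Type*} (B : ℕ) (z₁ z₂ : ProdState S Q X) : Prop where
  state_eq : z₁.1 = z₂.1
  location_eq : z₁.2.1 = z₂.2.1
  relevant_iff : ∀ x, z₁.2.2 x ≤ B ↔ z₂.2.2 x ≤ B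
  agree : ∀ x, z₁.2.2 x ≤ B → AgreeOnIntegralPart (z₁.2.2 x) (z₂.2.2 x)
  fract_le_iff : ∀ x y, z₁.2.2 x ≤ B → z₁.2.2 y ≤ B →
    (Int.fract (z₁.2.2 x : ℝ) ≤ Int.fract (z₁.2.2 y : ℝ) ↔
      Int.fract (z₂.2.2 x : ℝ) ≤ Int.fract (z₂.2.2 y : ℝ))

/-- The region relation is an equivalence. -/
def regionSetoid (S Q X : Type*) (B : ℕ) : Setoid (ProdState S Q X) where
  r := RegionRel B
  iseqv :=
    { refl := fun _ => ⟨rfl, rfl, fun _ => Iff.rfl, fun _ _ => ⟨rfl, Iff.rfl⟩,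
        fun _ _ _ _ => Iff.rfl⟩
      symm := fun h => ⟨h.1.symm, h.2.symm, fun x => (h.3 x).symm,
        fun x hx => ⟨(h.4 x ((h.3 x).2 hx)).1.symm, (h.4 x ((h.3 x).2 hx)).2.symm⟩,
        fun x y hx hy => (h.5 x y ((h.3 x).2 hx) ((h.3 y).2 hy)).symm⟩
      trans := fun h k => ⟨h.1.trans k.1, h.2.trans k.2, fun x => (h.3 x).trans (k.3 x),
        fun x hx => ⟨(h.4 x hx).1.trans (k.4 x ((h.3 x).1 hx)).1,
          (h.4 x hx).2.trans (k.4 x ((h.3 x).1 hx)).2⟩,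
        fun x y hx hy => (h.5 x y hx hy).trans
          (k.5 x y ((h.3 x).1 hx) ((h.3 y).1 hy))⟩ }

/-- Regions: the equivalence classes of the region relation. -/
abbrev Region (S Q X : Type*) (B : ℕ) := Quotient (regionSetoid S Q X B)

/-- The set of states that belong to a region. -/
def Region.states {S Q X : Type*} {B : ℕ} (R : Region S Q X B) : Set (ProdState S Q X) :=
  {z | Quotient.mk _ z = R}

/-- The region relation has finite index. -/
theorem finite_region (S Q X : Type*) [Finite S] [Finite Q] [Finite X] (B : ℕ) :
    Finite (Region S Q X B) := by
  classical
  let code : ProdState S Q X →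
      S × Q × (X → Option (Fin (B + 1) × Prop)) × (X → X → Prop) := fun z =>
    (z.1, z.2.1, fun x => if h : z.2.2 x ≤ B then
        some (⟨⌊z.2.2 x⌋₊, Nat.lt_succ_of_le (Nat.floor_le_of_le h)⟩,
          Int.fract (z.2.2 x : ℝ) = 0) else none,
      fun x y => Int.fract (z.2.2 x : ℝ) ≤ Int.fract (z.2.2 y : ℝ))
  have key : ∀ z z', code z = code z' → RegionRel B z z' := by
    intro z z' h
    obtain ⟨h1, h2, h3, h4⟩ : _ ∧ _ ∧ _ ∧ _ := by simpa only [code, Prod.mk.injEq] using h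
    have h5 : ∀ x, z.2.2 x ≤ B ↔ z'.2.2 x ≤ B := by
      intro x
      have := congrFun h3 x
      by_cases hz : z.2.2 x ≤ B <;> by_cases hz' : z'.2.2 x ≤ B <;>
        simp only [hz, hz', dite_true, dite_false, reduceCtorEq] at this ⊢
    refine ⟨h1, h2, h5, fun x hx => ?_, fun x y _ _ => (congrFun (congrFun h4 x) y).to_iff⟩
    have h6 := congrFun h3 x
    rw [dif_pos hx, dif_pos ((h5 x).1 hx)] at h6
    simp only [Option.some.injEq, Prod.mk.injEq, Fin.mk.injEq] at h6
    refine ⟨?_, h6.2.to_iff⟩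
    rw [← Int.natCast_floor_eq_floor (NNReal.coe_nonneg _),
      ← Int.natCast_floor_eq_floor (NNReal.coe_nonneg _)]
    exact congrArg _ h6.1
  refine Finite.of_injective (fun R : Region S Q X B => code R.out) fun R R' h => ?_
  rw [← Quotient.out_eq R, ← Quotient.out_eq R']
  exact Quotient.sound (key _ _ h)

namespace SMP

variable {S Q X : Type*} [Fintype S] [MeasurableSpace S] [DiscreteMeasurableSpace S]
  [Finite Q] [MeasurableSpace Q] [DiscreteMeasurableSpace Q] [Finite X]

/-- The vertices of the region graph: the regions that are reachable with positive probability
in the product process. -/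
abbrev RegionVertex (M : SMP S) (T : DTA Q S X) :=
  {R : Region S Q X T.bMax // ∃ n : ℕ, 0 < (M.prodInit T).bind (M.prodKernel T ^ n) R.states}

/-- The edge relation of the region graph. -/
def RegionEdge (M : SMP S) (T : DTA Q S X) (R R' : M.RegionVertex T) : Prop :=
  ∃ z ∈ R.1.states, 0 < M.prodKernel T z R'.1.states

/-- `C` is a bottom strongly connected component of the region graph. -/
structure IsBSCC (M : SMP S) (T : DTA Q S X) (C : Set (M.RegionVertex T)) : Prop where
  nonempty : C.Nonempty
  connected : ∀ R ∈ C, ∀ R' ∈ C, Relation.ReflTransGen (M.RegionEdge T) R R'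
  closed : ∀ R ∈ C, ∀ R', M.RegionEdge T R R' → R' ∈ C

/-- The set of states that belong to some region of `C`. -/
def statesOf (M : SMP S) (T : DTA Q S X) (C : Set (M.RegionVertex T)) : Set (ProdState S Q X) :=
  ⋃ R ∈ C, R.1.states

/-- The runs of the semi-Markov process whose run of the product process visits `C`. -/
def runsReaching (M : SMP S) (T : DTA Q S X) (C : Set (M.RegionVertex T)) : Set (ℕ → S × ℝ≥0) :=
  {σ | ∃ n, T.prodRun σ n ∈ M.statesOf T C}

end SMP

/-! The vertices from which there is no return-free exit, that is, those of the bottom components,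
form a set U that no edge leaves; the same holds for C and for U without C. A run that visits C at
some time but is not in C at time i is therefore almost surely outside U at time i: inside U but
outside C it could neither have left C before nor enter C later. So the left-hand side is at most
P^i(z₀, Uᶜ) (`IsBSCC.runMeasure_sub_le`), and since U is closed it suffices that every reachable
state enters U within c steps with probability at least (p_min c_𝔇 / c)^c
(`pow_le_pow_bottomVertices`, `IsClosedUnderEdges.pow_compl_le`).

The difficulty is uniformity over states. A short path to U exists in the region graph, but the
delays that follow it may form arbitrarily small intervals when the fractional parts of the clocks
are close together. The remedy is to describe a relevant clock by the absolute time of its last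
reset. Reset times do not move as time passes, and a region only records comparisons a ≤ b + k
between reset times and the current time, with k an integer (`PatternOn`, `Shadow`). A run may thus
be altered by shifting its jump times as long as these comparisons survive.

Let n = |V|. Reachable states have at most n + 1 distinct fractional parts among relevant clocks,
since each step creates at most one and each number between 2 and the final one needs a region of
its own. Hence the circle has a gap of length g ≥ 1/(n+3), which a shift of the time origin moves to
(0, g) (`exists_gap`). Run n + 1 steps whose times have fractional parts decreasing inside the gap
and increasing integral parts (`DescentStep`). A clock that stayed relevant without a reset would
have a new integral part each time and produce n + 1 different regions, so all relevant clocks have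
been reset inside the gap (`resetTimes_subset_image_of_descentStep`). The old reset times no longer
matter, and a generic path of fewer than n steps leads to U.

These at most 2n jump times have distinct fractional parts. Assign to them disjoint windows of width
w = 1/(2n(n+3)) inside the gap, ordered like the fractional parts. Every choice of times in the
windows gives the same regions (`IsPerturbation.patternOn_union`, `IsPerturbation.patternOn`), so
each step succeeds with probability at least p_min c_𝔇 w
(`IsDelayBound.mul_le_lintegral_of_stateShadow`). The stated constant follows from 2n(n+3) ≤ (4n)² =
c². -/

set_option linter.unusedSectionVars false

/-! ### Order patterns of reset times -/

/-- `φ` preserves all comparisons `a ≤ b + k`, `k ∈ ℤ`, between elements of `P`. -/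
def PatternOn (φ : ℝ → ℝ) (P : Set ℝ) : Prop :=
  ∀ a ∈ P, ∀ b ∈ P, ∀ k : ℤ, a ≤ b + k ↔ φ a ≤ φ b + k

theorem PatternOn.lt_iff {φ : ℝ → ℝ} {P : Set ℝ} (h : PatternOn φ P) {a b : ℝ} (ha : a ∈ P)
    (hb : b ∈ P) (k : ℤ) : a < b + k ↔ φ a < φ b + k := by
  have := h b hb a ha (-k)
  push_cast at this
  rw [← not_le, ← not_le, not_iff_not]
  constructor
  · intro h'; linarith [this.1 (by linarith)]
  · intro h'; linarith [this.2 (by linarith)]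

/-- The comparisons `a ≤ b + k` are lexicographic in integral and fractional parts. -/
theorem le_add_intCast_iff (a b : ℝ) (k : ℤ) :
    a ≤ b + k ↔ ⌊a⌋ < ⌊b⌋ + k ∨ ⌊a⌋ = ⌊b⌋ + k ∧ Int.fract a ≤ Int.fract b := by
  have ha := Int.floor_add_fract a
  have hb := Int.floor_add_fract b
  have := Int.fract_nonneg a
  have := Int.fract_nonneg b
  have := Int.fract_lt_one a
  have := Int.fract_lt_one b
  rcases lt_trichotomy ⌊a⌋ (⌊b⌋ + k) with h | h | h
  · have h' : (⌊a⌋ : ℝ) + 1 ≤ ⌊b⌋ + k := by exact_mod_cast h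
    simp only [h, true_or, iff_true]
    linarith
  · have h' : (⌊a⌋ : ℝ) = ⌊b⌋ + k := by exact_mod_cast h
    simp only [h, lt_irrefl, false_or, true_and]
    constructor <;> intro <;> linarith
  · have h' : (⌊b⌋ : ℝ) + k + 1 ≤ ⌊a⌋ := by exact_mod_cast h
    simp only [h.not_gt, h.ne', false_and, or_false, iff_false]
    linarith

theorem le_add_intCast_congr {a b a' b' : ℝ} (ha : ⌊a⌋ = ⌊a'⌋) (hb : ⌊b⌋ = ⌊b'⌋)
    (h : Int.fract a ≤ Int.fract b ↔ Int.fract a' ≤ Int.fract b') (k : ℤ) :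
    a ≤ b + k ↔ a' ≤ b' + k := by
  rw [le_add_intCast_iff, le_add_intCast_iff a', ha, hb, h]

theorem agreeOnIntegralPart_of_forall {a b : ℝ} (h : ∀ k : ℤ, a ≤ k ↔ b ≤ k)
    (h' : ∀ k : ℤ, (k : ℝ) ≤ a ↔ (k : ℝ) ≤ b) : AgreeOnIntegralPart a b := by
  have hf : ⌊a⌋ = ⌊b⌋ := eq_of_forall_le_iff fun k => by
    rw [Int.le_floor, Int.le_floor, h']
  refine ⟨hf, ?_⟩
  have key (c : ℝ) : Int.fract c = 0 ↔ c ≤ ⌊c⌋ := by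
    have := Int.floor_add_fract c
    have := Int.fract_nonneg c
    constructor <;> intro <;> linarith
  rw [key, key, h, hf]

/-- The relevant clocks of `ν` are, at time `τ`, the clocks reset at the times `τ - ν x`. -/
def resetTimes {X : Type*} (B : ℕ) (τ : ℝ) (ν : ClockVal X) : Set ℝ :=
  {r | ∃ x, ν x ≤ B ∧ r = τ - ν x}

theorem resetTimes_le {X : Type*} {B : ℕ} {τ r : ℝ} {ν : ClockVal X}
    (h : r ∈ resetTimes B τ ν) : r ≤ τ := by
  obtain ⟨x, -, rfl⟩ := h
  linarith [(ν x).coe_nonneg]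

theorem finite_resetTimes {X : Type*} [Finite X] (B : ℕ) (τ : ℝ) (ν : ClockVal X) :
    (resetTimes B τ ν).Finite := by
  refine (Set.finite_range fun x => τ - (ν x : ℝ)).subset ?_
  rintro _ ⟨x, -, rfl⟩
  exact ⟨x, rfl⟩

/-- `ν'` arises from `ν` by moving the current time `τ` and the reset times of the relevant
clocks with `φ`; clocks that are irrelevant for `ν` are irrelevant for `ν'`. -/
def Shadow {X : Type*} (B : ℕ) (τ : ℝ) (φ : ℝ → ℝ) (ν ν' : ClockVal X) : Prop :=
  ∀ x, ((B : ℝ≥0) < ν x ∧ (B : ℝ≥0) < ν' x) ∨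
    (ν x ≤ B ∧ (ν' x : ℝ) = φ τ - φ (τ - ν x))

theorem Shadow.congr {X : Type*} {B : ℕ} {τ : ℝ} {φ φ' : ℝ → ℝ} {ν ν' : ClockVal X}
    (h : Shadow B τ φ ν ν') (hφ : ∀ a ≤ τ, φ' a = φ a) : Shadow B τ φ' ν ν' := by
  intro x
  refine (h x).imp_right fun ⟨h1, h2⟩ => ⟨h1, ?_⟩
  rw [hφ _ le_rfl, hφ _ (by linarith [(ν x).coe_nonneg]), h2]

theorem Shadow.refl {X : Type*} {B : ℕ} {τ : ℝ} {φ : ℝ → ℝ} {ν : ClockVal X}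
    (hτ : φ τ = τ) (h : ∀ r ∈ resetTimes B τ ν, φ r = r) : Shadow B τ φ ν ν := by
  intro x
  rcases lt_or_ge (B : ℝ≥0) (ν x) with hx | hx
  · exact .inl ⟨hx, hx⟩
  · refine .inr ⟨hx, ?_⟩
    rw [hτ, h _ ⟨x, hx, rfl⟩]
    ring

section Shadow

variable {X : Type*} {B : ℕ} {τ : ℝ} {φ : ℝ → ℝ} {ν ν' : ClockVal X} {P : Set ℝ}

theorem Shadow.relevant_iff (h : Shadow B τ φ ν ν') (hφ : PatternOn φ P) (hτ : τ ∈ P)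
    (hν : resetTimes B τ ν ⊆ P) (x : X) : ν x ≤ B ↔ ν' x ≤ B := by
  rcases h x with ⟨h1, h2⟩ | ⟨h1, h2⟩
  · exact iff_of_false h1.not_ge h2.not_ge
  · refine iff_of_true h1 ?_
    have h1' : (ν x : ℝ) ≤ B := by exact_mod_cast h1
    have := (hφ τ hτ _ (hν ⟨x, h1, rfl⟩) B).1 (by push_cast; linarith)
    push_cast at this
    have : (ν' x : ℝ) ≤ B := by linarith
    exact_mod_cast this

/-- A clock value is τ minus a reset time, so comparing it with an integer compares τ with that
reset time. Once the integral parts are known, comparing two fractional parts compares two reset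
times with the difference of the integral parts as offset. All of this is preserved by φ. -/
theorem Shadow.regionRel {S Q : Type*} {s : S} {q : Q} (h : Shadow B τ φ ν ν')
    (hφ : PatternOn φ P) (hτ : τ ∈ P) (hν : resetTimes B τ ν ⊆ P) :
    RegionRel B (s, q, ν) (s, q, ν') := by
  have hrel := h.relevant_iff hφ hτ hν
  have hval (x : X) (hx : ν x ≤ B) : (ν' x : ℝ) = φ τ - φ (τ - ν x) :=
    ((h x).resolve_left fun h => h.1.not_ge hx).2
  have hagree (x : X) (hx : ν x ≤ B) : AgreeOnIntegralPart (ν x) (ν' x) := by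
    rw [hval x hx]
    refine agreeOnIntegralPart_of_forall (fun k => ?_) (fun k => ?_)
    · have := hφ τ hτ _ (hν ⟨x, hx, rfl⟩) k
      constructor
      · intro h'; linarith [this.1 (by linarith)]
      · intro h'; linarith [this.2 (by linarith)]
    · have := hφ _ (hν ⟨x, hx, rfl⟩) τ hτ (-k)
      push_cast at this
      constructor
      · intro h'; linarith [this.1 (by linarith)]
      · intro h'; linarith [this.2 (by linarith)]
  refine ⟨rfl, rfl, hrel, hagree, fun x y hx hy => ?_⟩
  change ν x ≤ B at hx
  change ν y ≤ B at hy
  change Int.fract (ν x : ℝ) ≤ Int.fract (ν y : ℝ) ↔ Int.fract (ν' x : ℝ) ≤ Int.fract (ν' y : ℝ)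
  have := hφ _ (hν ⟨y, hy, rfl⟩) _ (hν ⟨x, hx, rfl⟩) (⌊(ν x : ℝ)⌋ - ⌊(ν y : ℝ)⌋)
  push_cast at this
  simp only [Int.fract, ← (hagree x hx).1, ← (hagree y hy).1]
  rw [hval x hx, hval y hy]
  constructor
  · intro h'; linarith [this.1 (by linarith)]
  · intro h'; linarith [this.2 (by linarith)]

/-- The clocks in Y acquire the reset time τ and the others keep theirs, so the same φ continues to
work; only the new current time must be mapped correctly. A clock that becomes irrelevant does so on
both sides, because its comparison with B is part of the pattern. -/
theorem Shadow.reset_delay (h : Shadow B τ φ ν ν') (hφ : PatternOn φ P) (hτ : τ ∈ P)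
    (hν : resetTimes B τ ν ⊆ P) (Y : Set X) {t t' : ℝ≥0} (ht : τ + t ∈ P)
    (ht' : φ (τ + t) = φ τ + t') :
    Shadow B (τ + t) φ ((ν.reset Y).delay t) ((ν'.reset Y).delay t') := by
  intro x
  have aux {a : ℝ} (ha : a ∈ P) : τ + t - a ≤ B ↔ φ (τ + t) - φ a ≤ B := by
    have := hφ _ ht _ ha B
    push_cast at this
    constructor
    · intro h'; linarith [this.1 (by linarith)]
    · intro h'; linarith [this.2 (by linarith)]
  have key (c c' : ℝ≥0) (hc : τ + t - c ∈ P) (hcc : (c' : ℝ) = φ (τ + t) - φ (τ + t - c)) :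
      ((B : ℝ≥0) < c ∧ (B : ℝ≥0) < c') ∨
        (c ≤ B ∧ (c' : ℝ) = φ (τ + t) - φ (τ + t - c)) := by
    have h1 : (c : ℝ) ≤ B ↔ (c' : ℝ) ≤ B := by
      rw [hcc, ← aux hc]
      simp
    rcases lt_or_ge (B : ℝ≥0) c with hB | hB
    · refine .inl ⟨hB, lt_of_not_ge fun h' => hB.not_ge ?_⟩
      exact_mod_cast h1.2 (by exact_mod_cast h')
    · exact .inr ⟨hB, hcc⟩
  by_cases hx : x ∈ Y
  · simp only [ClockVal.delay, ClockVal.reset, hx, if_true, zero_add]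
    refine key t t' (by simpa using hτ) ?_
    rw [add_sub_cancel_right, ht']
    ring
  · simp only [ClockVal.delay, ClockVal.reset, hx, if_false]
    rcases h x with ⟨h1, h2⟩ | ⟨h1, h2⟩
    · exact .inl ⟨h1.trans_le le_self_add, h2.trans_le le_self_add⟩
    · have hr : τ + t - ((ν x + t : ℝ≥0) : ℝ) = τ - ν x := by push_cast; ring
      refine key _ _ ?_ ?_
      · rw [hr]
        exact hν ⟨x, h1, rfl⟩
      · rw [hr, ht']
        push_cast
        rw [h2]
        ring

/-- After a delay above B no clock is relevant, so nothing is asked of φ'. -/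
theorem Shadow.reset_delay_of_lt (τ' : ℝ) (φ' : ℝ → ℝ) (ν ν' : ClockVal X) (Y : Set X) {t t' : ℝ≥0}
    (ht : (B : ℝ≥0) < t) (ht' : (B : ℝ≥0) < t') :
    Shadow B τ' φ' ((ν.reset Y).delay t) ((ν'.reset Y).delay t') :=
  fun _ => .inl ⟨ht.trans_le le_add_self, ht'.trans_le le_add_self⟩

theorem resetTimes_reset_delay_subset (Y : Set X) (t : ℝ≥0) :
    resetTimes B (τ + t) ((ν.reset Y).delay t) ⊆ insert τ (resetTimes B τ ν) := by
  rintro _ ⟨x, hx, rfl⟩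
  simp only [ClockVal.delay, ClockVal.reset] at hx ⊢
  by_cases hxY : x ∈ Y
  · left
    simp [hxY]
  · right
    simp only [hxY, if_false] at hx ⊢
    refine ⟨x, le_self_add.trans hx, ?_⟩
    push_cast
    ring

end Shadow

/-! ### Regions and guards -/

theorem ClockConstraint.sat_iff_of_regionRel {S Q X : Type*} {B : ℕ} {z z' : ProdState S Q X}
    (h : RegionRel B z z') (b : ClockConstraint X) (hb : b.bound ≤ B) :
    b.Sat z.2.2 ↔ b.Sat z'.2.2 := by
  obtain ⟨x, cmp, k⟩ := b
  change k ≤ B at hb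
  have hkB : (k : ℝ≥0) ≤ B := by exact_mod_cast hb
  have key : (z.2.2 x ≤ k ↔ z'.2.2 x ≤ k) ∧ (z.2.2 x < k ↔ z'.2.2 x < k) := by
    by_cases hx : z.2.2 x ≤ B
    · obtain ⟨h1, h2⟩ := h.agree x hx
      have e1 (c : ℝ≥0) : c < k ↔ ⌊(c : ℝ)⌋ < k := by
        rw [Int.floor_lt]
        exact_mod_cast Iff.rfl
      have e2 (c : ℝ≥0) : c ≤ k ↔ ⌊(c : ℝ)⌋ < k ∨ ⌊(c : ℝ)⌋ = k ∧ Int.fract (c : ℝ) = 0 := by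
        have := le_add_intCast_iff (c : ℝ) 0 k
        simp only [zero_add, Int.floor_zero, Int.fract_zero] at this
        rw [← (Int.fract_nonneg (c : ℝ)).ge_iff_eq', ← this]
        push_cast
        exact_mod_cast Iff.rfl
      rw [e1, e1, e2, e2, h1, h2]
      exact ⟨Iff.rfl, Iff.rfl⟩
    · have hx' := mt (h.relevant_iff x).2 hx
      exact ⟨iff_of_false (fun h => hx (h.trans hkB)) fun h => hx' (h.trans hkB),
        iff_of_false (fun h => hx (h.le.trans hkB)) fun h => hx' (h.le.trans hkB)⟩
  rcases cmp with _ | _ | _ | _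
  · exact key.2
  · exact key.1
  · simpa only [ClockConstraint.Sat, gt_iff_lt, not_le] using not_congr key.1
  · simpa only [ClockConstraint.Sat, ge_iff_le, not_lt] using not_congr key.2

theorem DTA.exists_step_eq {S Q X : Type*} (T : DTA Q S X) {z z' : ProdState S Q X}
    (h : RegionRel T.bMax z z') : ∃ q' Y, T.step z.2.1 z.2.2 z.1 = (q', z.2.2.reset Y) ∧
      T.step z'.2.1 z'.2.2 z'.1 = (q', z'.2.2.reset Y) := by
  obtain ⟨e, he, h1, h2, h3⟩ := T.total z.2.1 z.1 z.2.2
  refine ⟨e.tgt, e.reset, ?_, ?_⟩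
  · rw [← h1, ← h2]
    exact T.step_eq he h3
  · rw [← h.location_eq, ← h.state_eq, ← h1, ← h2]
    refine T.step_eq he fun b hb => ?_
    refine (ClockConstraint.sat_iff_of_regionRel h b ?_).1 (h3 b hb)
    exact (Finset.le_sup (f := fun b : ClockConstraint X => b.bound) hb).trans
      (Finset.le_sup (f := fun e : DTAEdge Q S X => e.guard.sup fun b => b.bound) he)

theorem DTA.exists_move_eq {S Q X : Type*} (T : DTA Q S X) {z z' : ProdState S Q X}
    (h : RegionRel T.bMax z z') : ∃ q' Y,
      (∀ p, T.move z p = (p.1, q', (z.2.2.reset Y).delay p.2)) ∧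
      (∀ p, T.move z' p = (p.1, q', (z'.2.2.reset Y).delay p.2)) := by
  obtain ⟨q', Y, h1, h2⟩ := T.exists_step_eq h
  exact ⟨q', Y, fun p => by simp only [DTA.move, h1], fun p => by simp only [DTA.move, h2]⟩

/-- A map that realizes the passage from a valuation to a valuation in the same region. -/
theorem RegionRel.exists_shadow {S Q X : Type*} {B : ℕ} {z z' : ProdState S Q X}
    (h : RegionRel B z z') : ∃ φ : ℝ → ℝ, Shadow B 0 φ z.2.2 z'.2.2 ∧
      PatternOn φ (insert 0 (resetTimes B 0 z.2.2)) := by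
  classical
  obtain ⟨s, q, ν⟩ := z
  obtain ⟨s', q', ν'⟩ := z'
  -- Clocks with a common reset time have equal values in ν, hence also in ν', so the choice does
  -- not matter. The default 0 covers the current time; if a relevant clock is 0 in ν, it is 0 in ν'
  -- as well, and the two cases agree.
  let φ : ℝ → ℝ := fun a => if h : ∃ x, ν x ≤ B ∧ a = 0 - ν x then -ν' h.choose else 0
  have hag := h.agree
  have hfr := h.fract_le_iff
  simp only at hag hfr
  have hφ (x : X) (hx : ν x ≤ B) : φ (0 - ν x) = -ν' x := by
    have hex : ∃ y, ν y ≤ B ∧ (0 : ℝ) - ν x = 0 - ν y := ⟨x, hx, rfl⟩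
    simp only [φ, dif_pos hex]
    obtain ⟨h1, h2⟩ := hex.choose_spec
    set y := hex.choose
    have h3 : (ν x : ℝ) = ν y := by linarith
    have h4 : Int.fract (ν' x : ℝ) = Int.fract (ν' y : ℝ) :=
      le_antisymm ((hfr x y hx h1).1 (by rw [h3])) ((hfr y x h1 hx).1 (by rw [h3]))
    rw [← Int.floor_add_fract (ν' x : ℝ), ← Int.floor_add_fract (ν' y : ℝ), h4,
      ← (hag x hx).1, ← (hag y h1).1, h3]
  have hφ0 : φ 0 = 0 := by
    by_cases hex : ∃ y, ν y ≤ B ∧ (0 : ℝ) = 0 - ν y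
    · obtain ⟨y, hy, hy0⟩ := hex
      have h0 : (ν y : ℝ) = 0 := by linarith
      have h1 := hφ y hy
      rw [← hy0] at h1
      rw [h1, ← Int.floor_add_fract (ν' y : ℝ), ← (hag y hy).1, (hag y hy).2.1 (by simp [h0]), h0]
      simp
    · simp only [φ, dif_neg hex]
  refine ⟨φ, fun x => ?_, ?_⟩
  · rcases lt_or_ge (B : ℝ≥0) (ν x) with hx | hx
    · exact .inl ⟨hx, lt_of_not_ge (mt (h.relevant_iff x).2 hx.not_ge)⟩
    · refine .inr ⟨hx, ?_⟩
      simp only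
      rw [hφ x hx, hφ0]
      ring
  · have hneg (a b : ℝ) (k : ℤ) : -a ≤ -b + k ↔ b ≤ a + k := by
      constructor <;> intro <;> linarith
    rintro a (rfl | ⟨x, hx, rfl⟩) b (rfl | ⟨y, hy, rfl⟩) k
    · rw [hφ0]
    · change ν y ≤ B at hy
      rw [hφ0, hφ y hy, zero_sub]
      have := le_add_intCast_congr (hag y hy).1 (rfl : ⌊(0 : ℝ)⌋ = ⌊(0 : ℝ)⌋) (by
        rw [Int.fract_zero, (Int.fract_nonneg _).ge_iff_eq', (Int.fract_nonneg _).ge_iff_eq',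
          (hag y hy).2]) k
      rw [← neg_zero, hneg, hneg]
      exact this
    · change ν x ≤ B at hx
      rw [hφ0, hφ x hx, zero_sub]
      have := le_add_intCast_congr (rfl : ⌊(0 : ℝ)⌋ = ⌊(0 : ℝ)⌋) (hag x hx).1 (by
        simp only [Int.fract_zero, Int.fract_nonneg]) k
      rw [← neg_zero, hneg, hneg]
      exact this
    · change ν x ≤ B at hx
      change ν y ≤ B at hy
      rw [hφ x hx, hφ y hy, zero_sub, zero_sub, hneg, hneg]
      exact le_add_intCast_congr (hag y hy).1 (hag x hx).1 (hfr y x hy hx) k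

/-! ### Delay densities -/

theorem IsDelayDensity.measurable {f : ℝ → ℝ≥0} (hf : IsDelayDensity f) : Measurable f := hf.1

theorem IsDelayDensity.lintegral_delayMeasure {f : ℝ → ℝ≥0} (hf : IsDelayDensity f)
    {g : ℝ≥0 → ℝ≥0∞} (hg : Measurable g) :
    ∫⁻ t, g t ∂(delayMeasure f) = ∫⁻ t : ℝ, f t * g t.toNNReal := by
  have := hf.measurable
  rw [delayMeasure, lintegral_map hg (by fun_prop),
    lintegral_withDensity_eq_lintegral_mul _ (by fun_prop) (by fun_prop)]
  rfl

/-- A delay density is bounded away from zero on every unit interval with integral end points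
in which it does not vanish. -/
theorem IsDelayDensity.exists_forall_le {f : ℝ → ℝ≥0} (hf : IsDelayDensity f) {t : ℝ}
    (ht : f t ≠ 0) (hfr : Int.fract t ≠ 0) :
    ∃ b : ℝ≥0, 0 < b ∧ ∀ u ∈ Set.Icc (⌊t⌋ : ℝ) (⌊t⌋ + 1), b ≤ f u := by
  obtain ⟨-, -, -, I, hI, h0, hpos⟩ := hf
  refine hpos _ _ ?_
  have htI : t ∈ I := by
    by_contra h
    exact ht (h0 t h)
  have hlt : (⌊t⌋ : ℝ) < t :=
    (Int.floor_le t).lt_of_ne fun h => hfr (by rw [Int.fract, h, sub_self])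
  rcases hI with ⟨l, u, -, rfl⟩ | ⟨l, rfl⟩
  · refine Set.Icc_subset_Icc ?_ ?_
    · exact_mod_cast Int.le_floor.2 (by exact_mod_cast htI.1)
    · have : (⌊t⌋ : ℝ) < (u : ℤ) := hlt.trans_le (by exact_mod_cast htI.2)
      exact_mod_cast Int.add_one_le_iff.2 (by exact_mod_cast this)
  · refine Set.Icc_subset_Ici_self.trans (Set.Ici_subset_Ici.2 ?_)
    exact_mod_cast Int.le_floor.2 (by exact_mod_cast htI)

/-- The support of a delay density contains a unit interval with integral end points. -/
theorem IsDelayDensity.exists_unit_interval {f : ℝ → ℝ≥0} (hf : IsDelayDensity f) :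
    ∃ l : ℕ, ∀ t ∈ Set.Icc (l : ℝ) (l + 1), f t ≠ 0 := by
  obtain ⟨-, -, -, I, hI, -, hpos⟩ := hf
  have key (l : ℕ) (h : Set.Icc (l : ℝ) (l + 1) ⊆ I) :
      ∃ l : ℕ, ∀ t ∈ Set.Icc (l : ℝ) (l + 1), f t ≠ 0 := by
    obtain ⟨b, hb, hb'⟩ := hpos _ _ h
    exact ⟨l, fun t ht => (hb.trans_le (hb' t ht)).ne'⟩
  rcases hI with ⟨l, u, hlu, rfl⟩ | ⟨l, rfl⟩
  · exact key l (Set.Icc_subset_Icc le_rfl (by exact_mod_cast hlu))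
  · exact key l Set.Icc_subset_Ici_self

/-- The delay law is absolutely continuous, so countable sets are negligible. This is the source of
generic delays. -/
theorem IsDelayDensity.exists_of_delayMeasure_pos {f : ℝ → ℝ≥0} (hf : IsDelayDensity f)
    {A : Set ℝ≥0} (hA : MeasurableSet A) (h : 0 < delayMeasure f A) {N : Set ℝ}
    (hN : N.Countable) : ∃ t : ℝ≥0, t ∈ A ∧ f t ≠ 0 ∧ (t : ℝ) ∉ N := by
  by_contra! hcon
  refine h.ne' ?_
  have hfm := hf.measurable
  have hAm := measurable_one.indicator hA (f := fun _ : ℝ≥0 => (1 : ℝ≥0∞))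
  rw [← lintegral_indicator_one hA, hf.lintegral_delayMeasure (measurable_one.indicator hA),
    lintegral_eq_zero_iff' (by fun_prop)]
  filter_upwards [hN.ae_notMem volume] with t ht
  rcases lt_or_ge t 0 with h0 | h0
  · simp [hf.2.1 t h0]
  · by_cases htA : t.toNNReal ∈ A
    · by_cases hft : f t = 0
      · simp [hft]
      · refine absurd (hcon t.toNNReal htA ?_) ?_ <;> simpa [Real.coe_toNNReal t h0]
    · simp [htA]

/-! ### The transition kernel of the product process -/

theorem measurableSet_states {S Q X : Type*} [Finite S] [MeasurableSpace S]
    [DiscreteMeasurableSpace S] [Finite Q] [MeasurableSpace Q] [DiscreteMeasurableSpace Q]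
    [Finite X] {B : ℕ} (R : Region S Q X B) : MeasurableSet R.states := by
  have : R.states = {z | (R.out.1 = z.1 ∧ R.out.2.1 = z.2.1) ∧
      (∀ x, R.out.2.2 x ≤ (B : ℝ≥0) ↔ z.2.2 x ≤ (B : ℝ≥0)) ∧
      (∀ x, R.out.2.2 x ≤ B → ⌊(R.out.2.2 x : ℝ)⌋ = ⌊(z.2.2 x : ℝ)⌋ ∧
        (Int.fract (R.out.2.2 x : ℝ) = 0 ↔ Int.fract (z.2.2 x : ℝ) = 0)) ∧
      ∀ x y, R.out.2.2 x ≤ B → R.out.2.2 y ≤ B →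
        (Int.fract (R.out.2.2 x : ℝ) ≤ Int.fract (R.out.2.2 y : ℝ) ↔
          Int.fract (z.2.2 x : ℝ) ≤ Int.fract (z.2.2 y : ℝ))} := by
    ext z
    have : z ∈ R.states ↔ RegionRel B R.out z := by
      rw [Region.states, Set.mem_ofPred_eq, ← Quotient.out_eq R, eq_comm, Quotient.eq]
      rw [Quotient.out_eq]
      rfl
    rw [this]
    exact ⟨fun h => ⟨⟨h.1, h.2⟩, h.3, h.4, h.5⟩, fun h => ⟨h.1.1, h.1.2, h.2.1, h.2.2.1, h.2.2.2⟩⟩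
  rw [this]
  have hx (x : X) : Measurable fun z : ProdState S Q X => (z.2.2 x : ℝ) := by fun_prop
  have hx' (x : X) : Measurable fun z : ProdState S Q X => z.2.2 x := by fun_prop
  have hfl (x : X) : Measurable fun z : ProdState S Q X => ⌊(z.2.2 x : ℝ)⌋ := (hx x).floor
  have hfr (x : X) : Measurable fun z : ProdState S Q X => Int.fract (z.2.2 x : ℝ) := (hx x).fract
  refine MeasurableSet.inter (MeasurableSet.inter ?_ ?_) (MeasurableSet.inter ?_
    (MeasurableSet.inter ?_ ?_))
  · exact measurableSet_eq_fun measurable_const measurable_fst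
  · exact measurableSet_eq_fun measurable_const measurable_snd.fst
  · refine measurableSet_setOfPred.2 (Measurable.forall fun x => ?_)
    exact Measurable.iff measurable_const (measurableSet_setOfPred.1
      (measurableSet_le (hx' x) measurable_const))
  · refine measurableSet_setOfPred.2 (Measurable.forall fun x => Measurable.imp measurable_const ?_)
    refine Measurable.and ?_ (Measurable.iff measurable_const ?_)
    · exact measurableSet_setOfPred.1 (measurableSet_eq_fun measurable_const (hfl x))
    · exact measurableSet_setOfPred.1 (measurableSet_eq_fun (hfr x) measurable_const)
  · refine measurableSet_setOfPred.2 (Measurable.forall fun x => Measurable.forall fun y =>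
      Measurable.imp measurable_const <| Measurable.imp measurable_const <|
        Measurable.iff measurable_const ?_)
    exact measurableSet_setOfPred.1 (measurableSet_le (hfr x) (hfr y))

namespace SMP

variable {S Q X : Type*} [Fintype S] [MeasurableSpace S] [DiscreteMeasurableSpace S]
  [Finite Q] [MeasurableSpace Q] [DiscreteMeasurableSpace Q] [Finite X]
  (M : SMP S) (T : DTA Q S X)

theorem measurable_move_right (z : ProdState S Q X) : Measurable (T.move z) :=
  T.measurable_move.comp (by fun_prop : Measurable fun p : S × ℝ≥0 => (z, p))

theorem measurable_move_delay (z : ProdState S Q X) (s' : S) :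
    Measurable fun t : ℝ≥0 => T.move z (s', t) :=
  (measurable_move_right T z).comp (by fun_prop)

theorem lintegral_prodKernel (z : ProdState S Q X) {g : ProdState S Q X → ℝ≥0∞}
    (hg : Measurable g) : ∫⁻ z', g z' ∂(M.prodKernel T z) =
      ∑ s', M.trans z.1 s' * ∫⁻ t : ℝ, M.delay z.1 s' t * g (T.move z (s', t.toNNReal)) := by
  have hm := measurable_move_right T z
  rw [prodKernel_apply, lintegral_map hg hm]
  change ∫⁻ p, _ ∂(∑ s', M.trans z.1 s' • (delayMeasure (M.delay z.1 s')).map (Prod.mk s')) = _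
  rw [lintegral_finsetSum_measure]
  refine Finset.sum_congr rfl fun s' _ => ?_
  rw [lintegral_smul_measure,
    lintegral_map (f := fun p => g (T.move z p)) (hg.comp hm) (by fun_prop),
    (M.isDelayDensity_delay z.1 s').lintegral_delayMeasure
      (g := fun t => g (T.move z (s', t))) (hg.comp (measurable_move_delay T z s')), smul_eq_mul]

/-- Discard all successors except s' and all delays outside W. -/
theorem mul_le_lintegral_prodKernel (z : ProdState S Q X) {g : ProdState S Q X → ℝ≥0∞}
    (hg : Measurable g) (s' : S) {W : Set ℝ} (hW : MeasurableSet W) {κ : ℝ≥0∞}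
    (h : ∀ t ∈ W, κ ≤ g (T.move z (s', t.toNNReal))) :
    M.trans z.1 s' * (∫⁻ t in W, M.delay z.1 s' t) * κ ≤ ∫⁻ z', g z' ∂(M.prodKernel T z) := by
  have hf := (M.isDelayDensity_delay z.1 s').measurable
  rw [lintegral_prodKernel M T z hg, mul_assoc]
  refine le_trans ?_ (Finset.single_le_sum (fun _ _ => zero_le) (Finset.mem_univ s'))
  gcongr
  rw [← lintegral_mul_const _ (by fun_prop)]
  calc ∫⁻ t in W, M.delay z.1 s' t * κ
      ≤ ∫⁻ t in W, M.delay z.1 s' t * g (T.move z (s', t.toNNReal)) :=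
        setLIntegral_mono' hW fun t ht => by gcongr; exact h t ht
    _ ≤ _ := setLIntegral_le_lintegral _ _

theorem exists_move_mem_of_pos {z : ProdState S Q X} {A : Set (ProdState S Q X)}
    (hA : MeasurableSet A) (h : 0 < M.prodKernel T z A) {N : Set ℝ} (hN : N.Countable) :
    ∃ (s' : S) (t : ℝ≥0), M.trans z.1 s' ≠ 0 ∧ M.delay z.1 s' t ≠ 0 ∧ (t : ℝ) ∉ N ∧
      T.move z (s', t) ∈ A := by
  rw [prodKernel_apply, Measure.map_apply (measurable_move_right T z) hA] at h
  change 0 < (∑ s', M.trans z.1 s' • (delayMeasure (M.delay z.1 s')).map (Prod.mk s')) _ at h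
  rw [Measure.finsetSum_apply] at h
  obtain ⟨s', -, hs'⟩ := Finset.exists_ne_zero_of_sum_ne_zero h.ne'
  rw [Measure.smul_apply, smul_eq_mul, Measure.map_apply (by fun_prop)
    (measurable_move_right T z hA)] at hs'
  obtain ⟨h1, h2⟩ := mul_ne_zero_iff.1 hs'
  obtain ⟨t, ht, ht', htN⟩ := (M.isDelayDensity_delay z.1 s').exists_of_delayMeasure_pos
    (measurable_move_delay T z s' hA) (pos_iff_ne_zero.2 h2) hN
  exact ⟨s', t, h1, ht', htN, ht⟩

end SMP

/-! ### Extension of order patterns -/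

/-- A pattern-preserving map on a finite set extends to a generic point, and the possible images
of this point form a nonempty open set. -/
theorem PatternOn.exists_extension {φ : ℝ → ℝ} {P : Set ℝ} (hφ : PatternOn φ P) (hP : P.Finite)
    (a : ℝ) : ∃ O : Set ℝ, IsOpen O ∧ O.Nonempty ∧
      ∀ y ∈ O, ∀ b ∈ P, φ b + ⌊a - b⌋ < y ∧ y < φ b + ⌊a - b⌋ + 1 := by
  refine ⟨⋂ b ∈ P, Set.Ioo (φ b + ⌊a - b⌋) (φ b + ⌊a - b⌋ + 1),
    hP.isOpen_biInter fun _ _ => isOpen_Ioo, ?_, fun y hy b hb => Set.mem_iInter₂.1 hy b hb⟩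
  -- The finitely many open intervals have a common point as soon as each lower end is below each
  -- upper end. For b and c in P this is a comparison of b with c up to an integer, which φ
  -- preserves.
  obtain ⟨m, hm1, hm2⟩ := Order.exists_between_finsets
    (hP.toFinset.image fun b => φ b + ⌊a - b⌋) (hP.toFinset.image fun b => φ b + ⌊a - b⌋ + 1) (by
      intro x hx y hy
      obtain ⟨b, hb, rfl⟩ := Finset.mem_image.1 hx
      obtain ⟨c, hc, rfl⟩ := Finset.mem_image.1 hy
      rw [Set.Finite.mem_toFinset] at hb hc
      have h1 := Int.floor_le (a - b)
      have h2 := Int.lt_floor_add_one (a - c)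
      have := (hφ.lt_iff hb hc (⌊a - c⌋ + 1 - ⌊a - b⌋)).1 (by push_cast; linarith)
      push_cast at this
      linarith)
  refine ⟨m, Set.mem_iInter₂.2 fun b hb => ⟨?_, ?_⟩⟩
  · exact hm1 _ (Finset.mem_image_of_mem _ (hP.mem_toFinset.2 hb))
  · exact hm2 _ (Finset.mem_image_of_mem _ (hP.mem_toFinset.2 hb))

/-- No a - b is an integer, so ⌊a - b⌋ decides every comparison of a with b up to an integer, in
both directions and strictly. -/
theorem PatternOn.insert {φ : ℝ → ℝ} {P : Set ℝ} (hφ : PatternOn φ P) {a : ℝ}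
    (ha : ∀ b ∈ P, Int.fract (a - b) ≠ 0)
    (h : ∀ b ∈ P, φ b + ⌊a - b⌋ < φ a ∧ φ a < φ b + ⌊a - b⌋ + 1) :
    PatternOn φ (insert a P) := by
  have key (b : ℝ) (hb : b ∈ P) (k : ℤ) :
      (a ≤ b + k ↔ φ a ≤ φ b + k) ∧ (b ≤ a + k ↔ φ b ≤ φ a + k) := by
    obtain ⟨h1, h2⟩ := h b hb
    have h3 := Int.floor_le (a - b)
    have h4 := Int.lt_floor_add_one (a - b)
    have h3' : (⌊a - b⌋ : ℝ) < a - b :=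
      h3.lt_of_ne fun h => ha b hb (by rw [Int.fract, h, sub_self])
    constructor
    · rcases lt_or_ge ⌊a - b⌋ k with hk | hk
      · have : (⌊a - b⌋ : ℝ) + 1 ≤ k := by exact_mod_cast hk
        exact iff_of_true (by linarith) (by linarith)
      · have : (k : ℝ) ≤ ⌊a - b⌋ := by exact_mod_cast hk
        exact iff_of_false (by linarith) (by linarith)
    · rcases lt_or_ge ⌊a - b⌋ (-k) with hk | hk
      · have : (⌊a - b⌋ : ℝ) + 1 ≤ -k := by exact_mod_cast hk
        exact iff_of_false (by linarith) (by linarith)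
      · have : (-k : ℝ) ≤ ⌊a - b⌋ := by exact_mod_cast hk
        exact iff_of_true (by linarith) (by linarith)
  rintro b (rfl | hb) c (rfl | hc) k
  · simp only [le_add_iff_nonneg_right]
  · exact (key c hc k).1
  · exact (key b hb k).2
  · exact hφ b hb c hc k

/-- The region of a state. -/
abbrev regionOf {S Q X : Type*} (T : DTA Q S X) (z : ProdState S Q X) :
    Region S Q X T.bMax := Quotient.mk _ z

/-- The delays to be avoided if all fractional parts are to be separated after the delay. -/
def criticalDelays {X : Type*} (B : ℕ) (ν : ClockVal X) : Set ℝ :=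
  {t | ∃ b ∈ insert 0 (resetTimes B 0 ν), Int.fract (t - b) = 0}

theorem countable_fract_sub_eq_zero {P : Set ℝ} (hP : P.Countable) (c : ℝ) :
    {t : ℝ | ∃ b ∈ P, Int.fract (c + t - b) = 0}.Countable := by
  have : {t : ℝ | ∃ b ∈ P, Int.fract (c + t - b) = 0} ⊆
      ⋃ b ∈ P, Set.range fun k : ℤ => b + k - c := by
    rintro t ⟨b, hb, h⟩
    refine Set.mem_iUnion₂.2 ⟨b, hb, ⌊c + t - b⌋, ?_⟩
    have := Int.floor_add_fract (c + t - b)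
    dsimp only
    linarith
  exact (hP.biUnion fun b _ => Set.countable_range _).mono this

theorem countable_criticalDelays {X : Type*} [Finite X] (B : ℕ) (ν : ClockVal X) :
    (criticalDelays B ν).Countable := by
  have := countable_fract_sub_eq_zero ((finite_resetTimes B 0 ν).insert 0).countable 0
  simp only [zero_add] at this
  exact this

namespace SMP

variable {S Q X : Type*} [Fintype S] [MeasurableSpace S] [DiscreteMeasurableSpace S]
  [Finite Q] [MeasurableSpace Q] [DiscreteMeasurableSpace Q] [Finite X]
  (M : SMP S) (T : DTA Q S X)

/-- The region entered with a generic delay is entered with positive probability from every state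
of the same region. -/
theorem prodKernel_pos_of_regionRel {z z' : ProdState S Q X} (h : RegionRel T.bMax z z') {s' : S}
    {t : ℝ≥0} (hs' : M.trans z.1 s' ≠ 0) (ht : M.delay z.1 s' t ≠ 0)
    (hcrit : (t : ℝ) ∉ criticalDelays T.bMax z.2.2) :
    0 < M.prodKernel T z' (regionOf T (T.move z (s', t))).states := by
  obtain ⟨φ, hsh, hpat⟩ := h.exists_shadow
  set P := insert 0 (resetTimes T.bMax 0 z.2.2)
  have hgen : ∀ b ∈ P, Int.fract ((t : ℝ) - b) ≠ 0 := fun b hb h => hcrit ⟨b, hb, h⟩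
  have hfr : Int.fract (t : ℝ) ≠ 0 := by simpa using hgen 0 (Set.mem_insert _ _)
  obtain ⟨O, hO, hOne, hOP⟩ := hpat.exists_extension
    ((finite_resetTimes T.bMax 0 z.2.2).insert 0) t
  have ht0 : (0 : ℝ) < t := t.coe_nonneg.lt_of_ne fun h => hfr (by rw [← h, Int.fract_zero])
  -- The delays that put the new time at an admissible image of t. Comparison with the current time
  -- 0 confines them to the unit interval around t, where the density is bounded below.
  let W : Set ℝ := (fun u => φ 0 + u) ⁻¹' O
  have hW : IsOpen W := hO.preimage (by fun_prop)
  have hWt : ∀ u ∈ W, (⌊(t : ℝ)⌋ : ℝ) < u ∧ u < ⌊(t : ℝ)⌋ + 1 := by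
    intro u hu
    have := hOP _ hu 0 (Set.mem_insert _ _)
    rw [sub_zero] at this
    constructor <;> linarith
  have hfl : (0 : ℝ) ≤ ⌊(t : ℝ)⌋ := by exact_mod_cast Int.floor_nonneg.2 t.coe_nonneg
  have hmeas := measurableSet_states (regionOf T (T.move z (s', t)))
  have key : ∀ u ∈ W, (1 : ℝ≥0∞) ≤
      (regionOf T (T.move z (s', t))).states.indicator 1 (T.move z' (s', u.toNNReal)) := by
    intro u hu
    have hu0 : 0 ≤ u := hfl.trans (hWt u hu).1.le
    rw [Set.indicator_of_mem, Pi.one_apply]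
    obtain ⟨q', Y, h1, h2⟩ := T.exists_move_eq h
    rw [Region.states, Set.mem_ofPred_eq, Quotient.eq, h1, h2]
    refine (regionSetoid S Q X T.bMax).symm ?_
    let φ' := Function.update φ t (φ 0 + u)
    have hφ' : ∀ a ≤ (0 : ℝ), φ' a = φ a := fun a ha =>
      Function.update_of_ne (by linarith) _ _
    have hP0 : ∀ b ∈ P, b ≤ 0 := by
      rintro b (rfl | hb)
      · rfl
      · exact resetTimes_le hb
    have hpat' : PatternOn φ' P := by
      intro a ha b hb k
      rw [hφ' a (hP0 a ha), hφ' b (hP0 b hb)]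
      exact hpat a ha b hb k
    have hpat'' : PatternOn φ' (insert (t : ℝ) P) := by
      refine hpat'.insert hgen fun b hb => ?_
      rw [hφ' b (hP0 b hb)]
      simpa only [φ', Function.update_self] using hOP _ hu b hb
    have hsh' := (hsh.congr hφ').reset_delay (t := t) (t' := u.toNNReal) hpat'' (by simp [P])
      ((Set.subset_insert _ _).trans (Set.subset_insert _ _)) Y (by simp)
      (by rw [zero_add, hφ' 0 le_rfl, Real.coe_toNNReal u hu0]; simp [φ'])
    refine hsh'.regionRel hpat'' (by simp) ?_
    exact (resetTimes_reset_delay_subset Y t).trans (Set.subset_insert _ _)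
  have hf := M.isDelayDensity_delay z.1 s'
  obtain ⟨b, hb, hb'⟩ := hf.exists_forall_le ht hfr
  have hpos : 0 < ∫⁻ u in W, M.delay z'.1 s' u := by
    rw [← h.state_eq]
    calc (0 : ℝ≥0∞) < b * volume W := by
          refine ENNReal.mul_pos (by exact_mod_cast hb.ne') (hW.measure_pos _ ?_).ne'
          obtain ⟨y, hy⟩ := hOne
          exact ⟨y - φ 0, by simpa [W] using hy⟩
      _ = ∫⁻ u in W, b := by rw [setLIntegral_const]
      _ ≤ _ := setLIntegral_mono' hW.measurableSet fun u hu => by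
          exact_mod_cast hb' u ⟨(hWt u hu).1.le, (hWt u hu).2.le⟩
  have := mul_le_lintegral_prodKernel M T z' (measurable_one.indicator hmeas) s'
    hW.measurableSet key
  rw [lintegral_indicator_one hmeas, mul_one] at this
  refine lt_of_lt_of_le (ENNReal.mul_pos ?_ hpos.ne') this
  rwa [← h.state_eq]

/-- Critical delays are countable, so a transition of positive probability can be realized by a
generic delay. Consequently edges of the region graph do not depend on the representative. -/
theorem prodKernel_pos_congr {z z' : ProdState S Q X} (h : RegionRel T.bMax z z')
    {R : Region S Q X T.bMax} (hR : 0 < M.prodKernel T z R.states) :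
    0 < M.prodKernel T z' R.states := by
  obtain ⟨s', t, h1, h2, h3, h4⟩ := exists_move_mem_of_pos M T (measurableSet_states R) hR
    (countable_criticalDelays T.bMax z.2.2)
  have := prodKernel_pos_of_regionRel M T h h1 h2 h3
  rwa [show regionOf T (T.move z (s', t)) = R from h4] at this

end SMP

/-! ### Sets of vertices that no edge leaves -/

namespace SMP

variable {S Q X : Type*} [Fintype S] [MeasurableSpace S] [DiscreteMeasurableSpace S]
  [Finite Q] [MeasurableSpace Q] [DiscreteMeasurableSpace Q] [Finite X]
  (M : SMP S) (T : DTA Q S X)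

theorem prodInit_bind_pow_succ (n : ℕ) : (M.prodInit T).bind (M.prodKernel T ^ (n + 1)) =
    ((M.prodInit T).bind (M.prodKernel T ^ n)).bind (M.prodKernel T) := by
  rw [Measure.comp_assoc, pow_succ']
  rfl

theorem exists_bind_pow_pos_of_prodKernel_pos (R : M.RegionVertex T) {R' : Region S Q X T.bMax}
    {z : ProdState S Q X} (hz : z ∈ R.1.states) (h : 0 < M.prodKernel T z R'.states) :
    ∃ n : ℕ, 0 < (M.prodInit T).bind (M.prodKernel T ^ n) R'.states := by
  obtain ⟨n, hn⟩ := R.2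
  refine ⟨n + 1, ?_⟩
  have hR' := measurableSet_states R'
  rw [prodInit_bind_pow_succ, Measure.bind_apply hR' (Kernel.aemeasurable _)]
  refine lt_of_lt_of_le ?_ (setLIntegral_le_lintegral R.1.states _)
  rw [setLIntegral_pos_iff ((M.prodKernel T).measurable_coe hR')]
  refine hn.trans_le (measure_mono fun z' hz' => ⟨?_, hz'⟩)
  exact (prodKernel_pos_congr M T (Quotient.exact (hz.trans hz'.symm)) h).ne'

theorem mem_statesOf {A : Set (M.RegionVertex T)} {z : ProdState S Q X} :
    z ∈ M.statesOf T A ↔ ∃ R ∈ A, regionOf T z = R.1 := by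
  simp [statesOf, Region.states]

instance : Finite (M.RegionVertex T) :=
  have := finite_region S Q X T.bMax
  Subtype.finite

theorem measurableSet_statesOf (A : Set (M.RegionVertex T)) : MeasurableSet (M.statesOf T A) :=
  MeasurableSet.biUnion A.to_countable fun R _ => measurableSet_states R.1

/-- No edge of the region graph leaves `A`. -/
def IsClosedUnderEdges (A : Set (M.RegionVertex T)) : Prop :=
  ∀ R ∈ A, ∀ R', M.RegionEdge T R R' → R' ∈ A

variable {M T}

/-- There are finitely many regions, and one entered with positive probability is itself a vertex,
joined by an edge to the present one. -/
theorem IsClosedUnderEdges.prodKernel_compl {A : Set (M.RegionVertex T)}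
    (hA : M.IsClosedUnderEdges T A) {z : ProdState S Q X} (hz : z ∈ M.statesOf T A) :
    M.prodKernel T z (M.statesOf T A)ᶜ = 0 := by
  obtain ⟨R, hR, hzR⟩ := (mem_statesOf M T).1 hz
  have := finite_region S Q X T.bMax
  have hsub : (M.statesOf T A)ᶜ ⊆
      ⋃ R' ∈ {R' : Region S Q X T.bMax | M.prodKernel T z R'.states = 0}, R'.states := by
    intro z' hz'
    refine Set.mem_iUnion₂.2 ⟨regionOf T z', ?_, rfl⟩
    by_contra hpos
    have hpos : 0 < M.prodKernel T z (regionOf T z').states := pos_iff_ne_zero.2 hpos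
    have hv := exists_bind_pow_pos_of_prodKernel_pos M T R hzR hpos
    exact hz' ((mem_statesOf M T).2 ⟨⟨_, hv⟩, hA R hR ⟨_, hv⟩ ⟨z, hzR, hpos⟩, rfl⟩)
  refine measure_mono_null hsub ?_
  rw [measure_biUnion_null_iff (Set.to_countable _)]
  exact fun _ h => h

theorem IsClosedUnderEdges.pow_compl {A : Set (M.RegionVertex T)}
    (hA : M.IsClosedUnderEdges T A) {z : ProdState S Q X} (hz : z ∈ M.statesOf T A) (n : ℕ) :
    (M.prodKernel T ^ n) z (M.statesOf T A)ᶜ = 0 := by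
  have hm := (measurableSet_statesOf M T A).compl
  induction n with
  | zero =>
    rw [pow_zero]
    change Kernel.id z _ = 0
    rw [Kernel.id_apply, Measure.dirac_apply' _ hm]
    simpa using hz
  | succ n ih =>
    rw [Kernel.pow_succ_apply_eq_lintegral _ _ _ hm,
      lintegral_eq_zero_iff ((M.prodKernel T).measurable_coe hm)]
    filter_upwards [measure_eq_zero_iff_ae_notMem.1 ih] with z' hz'
    exact hA.prodKernel_compl (not_not.1 hz')

instance (n : ℕ) : IsMarkovKernel (M.prodKernel T ^ n) := by
  induction n with
  | zero => exact inferInstanceAs (IsMarkovKernel Kernel.id)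
  | succ n ih =>
    rw [pow_succ']
    exact Kernel.IsMarkovKernel.comp (M.prodKernel T) (M.prodKernel T ^ n)

theorem IsClosedUnderEdges.pow_add_compl_le {A : Set (M.RegionVertex T)}
    (hA : M.IsClosedUnderEdges T A) (z : ProdState S Q X) (m n : ℕ) :
    (M.prodKernel T ^ (m + n)) z (M.statesOf T A)ᶜ ≤
      (M.prodKernel T ^ m) z (M.statesOf T A)ᶜ := by
  have hm := (measurableSet_statesOf M T A).compl
  rw [Kernel.pow_add_apply_eq_lintegral _ _ _ _ hm, ← lintegral_indicator_one hm]
  refine lintegral_mono fun z' => ?_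
  by_cases hz' : z' ∈ M.statesOf T A
  · simp [hA.pow_compl hz']
  · rw [Set.indicator_of_mem (by exact hz')]
    exact prob_le_one

theorem isClosedUnderEdges_univ : M.IsClosedUnderEdges T Set.univ := fun _ _ _ _ => trivial

/-- If a closed set of vertices is left out for `c` steps with probability at most `q` from every
vertex, then it is left out for `i` steps with probability at most `q ^ (i / c)`. -/
theorem IsClosedUnderEdges.pow_compl_le {A : Set (M.RegionVertex T)}
    (hA : M.IsClosedUnderEdges T A) {z₀ : ProdState S Q X}
    (hz₀ : z₀ ∈ M.statesOf T Set.univ) {c : ℕ} {q : ℝ≥0∞}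
    (hq : ∀ z ∈ M.statesOf T Set.univ, (M.prodKernel T ^ c) z (M.statesOf T A)ᶜ ≤ q) (i : ℕ) :
    (M.prodKernel T ^ i) z₀ (M.statesOf T A)ᶜ ≤ q ^ (i / c) := by
  have hm := (measurableSet_statesOf M T A).compl
  have key (k : ℕ) : (M.prodKernel T ^ (c * k)) z₀ (M.statesOf T A)ᶜ ≤ q ^ k := by
    induction k with
    | zero =>
      have : IsProbabilityMeasure ((M.prodKernel T ^ (c * 0)) z₀) := inferInstance
      simpa using prob_le_one (μ := (M.prodKernel T ^ (c * 0)) z₀)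
    | succ k ih =>
      rw [Nat.mul_succ, Kernel.pow_add_apply_eq_lintegral _ _ _ _ hm]
      calc ∫⁻ z, (M.prodKernel T ^ c) z (M.statesOf T A)ᶜ ∂((M.prodKernel T ^ (c * k)) z₀)
          ≤ ∫⁻ z, q * (M.statesOf T A)ᶜ.indicator 1 z ∂((M.prodKernel T ^ (c * k)) z₀) := by
            refine lintegral_mono_ae ?_
            -- The bound `hq` is available only at reachable states; the set of all vertices is
            -- closed, so almost every state after c * k steps is one.
            filter_upwards [measure_eq_zero_iff_ae_notMem.1
              (isClosedUnderEdges_univ.pow_compl hz₀ (c * k))] with z hz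
            by_cases hzA : z ∈ M.statesOf T A
            · simp [hA.pow_compl hzA]
            · rw [Set.indicator_of_mem (by exact hzA), Pi.one_apply, mul_one]
              exact hq z (not_not.1 hz)
        _ = q * (M.prodKernel T ^ (c * k)) z₀ (M.statesOf T A)ᶜ := by
            rw [lintegral_const_mul _ (measurable_one.indicator hm), lintegral_indicator_one hm]
        _ ≤ q ^ (k + 1) := by
            rw [pow_succ']
            gcongr
  calc (M.prodKernel T ^ i) z₀ (M.statesOf T A)ᶜ
      = (M.prodKernel T ^ (c * (i / c) + i % c)) z₀ (M.statesOf T A)ᶜ := by rw [Nat.div_add_mod]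
    _ ≤ _ := (hA.pow_add_compl_le z₀ _ _).trans (key _)

/-! ### The law of the product run -/

variable (M T)

/-- The product run up to time `n` as a function of the states and delays seen so far. -/
noncomputable def historyState {S Q X : Type*} (T : DTA Q S X) :
    (n : ℕ) → (Finset.Iic n → S × ℝ≥0) → ProdState S Q X
  | 0, h => ((h ⟨0, Finset.mem_Iic.2 le_rfl⟩).1, T.init, 0)
  | n + 1, h => T.move
      (historyState T n (Preorder.frestrictLe₂ (π := fun _ => S × ℝ≥0) n.le_succ h))
      (h ⟨n + 1, Finset.mem_Iic.2 le_rfl⟩)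

theorem historyState_fst {S Q X : Type*} (T : DTA Q S X) (n : ℕ) (h : Finset.Iic n → S × ℝ≥0) :
    (historyState T n h).1 = (h ⟨n, Finset.mem_Iic.2 le_rfl⟩).1 := by
  cases n <;> rfl

theorem measurable_historyState (n : ℕ) : Measurable (historyState T n) := by
  induction n with
  | zero =>
    have h : Measurable fun h : Finset.Iic 0 → S × ℝ≥0 => (h ⟨0, Finset.mem_Iic.2 le_rfl⟩).1 :=
      (measurable_pi_apply _).fst
    exact h.prodMk measurable_const
  | succ n ih =>
    exact T.measurable_move.comp ((ih.comp (Preorder.measurable_frestrictLe₂ _)).prodMk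
      (measurable_pi_apply _))

/-- The run that is encoded by a sequence of jumps. -/
def runOfJumps {S : Type*} (y : ℕ → S × ℝ≥0) : ℕ → S × ℝ≥0 := fun n => ((y n).1, (y (n + 1)).2)

theorem measurable_runOfJumps : Measurable (runOfJumps (S := S)) := by
  unfold runOfJumps
  fun_prop

theorem prodRun_runOfJumps {S Q X : Type*} (T : DTA Q S X) (y : ℕ → S × ℝ≥0) (n : ℕ) :
    T.prodRun (runOfJumps y) n = historyState T n (Preorder.frestrictLe n y) := by
  induction n with
  | zero => rfl
  | succ n ih =>
    rw [DTA.prodRun, ih]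
    rfl

theorem jumpMeasure_eq_trajMeasure : M.jumpMeasure =
    Kernel.trajMeasure (X := fun _ => S × ℝ≥0) (M.init.toMeasure.map fun s => (s, (0 : ℝ≥0)))
      (fun n => M.stepKernel.comap (fun h => (h ⟨n, Finset.mem_Iic.2 le_rfl⟩).1)
        (by fun_prop)) := by
  rw [jumpMeasure, Kernel.trajMeasure, Measure.map_map (by fun_prop) (by fun_prop)]
  rfl

theorem isProbabilityMeasure_init_map :
    IsProbabilityMeasure (M.init.toMeasure.map fun s => (s, (0 : ℝ≥0))) :=
  Measure.isProbabilityMeasure_map (by fun_prop)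

instance : IsProbabilityMeasure M.jumpMeasure := by
  have := isProbabilityMeasure_init_map M
  rw [jumpMeasure_eq_trajMeasure]
  infer_instance

theorem measurable_prodRun (n : ℕ) : Measurable fun σ => T.prodRun σ n := by
  induction n with
  | zero =>
    have h : Measurable fun σ : ℕ → S × ℝ≥0 => (σ 0).1 := (measurable_pi_apply _).fst
    exact h.prodMk measurable_const
  | succ n ih => exact T.measurable_move.comp (ih.prodMk (by fun_prop))

theorem measurable_prodRun_runOfJumps (n : ℕ) : Measurable fun y => T.prodRun (runOfJumps y) n :=
  (measurable_prodRun T n).comp measurable_runOfJumps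

/-- The Markov property of the product run: under the trajectory measure the next jump is drawn from
the step kernel given the history, and the history enters only through the current product state. -/
theorem jumpMeasure_prodRun_mem_and_succ_mem (n : ℕ) {A A' : Set (ProdState S Q X)}
    (hA : MeasurableSet A) (hA' : MeasurableSet A') :
    M.jumpMeasure {y | T.prodRun (runOfJumps y) n ∈ A ∧ T.prodRun (runOfJumps y) (n + 1) ∈ A'} =
      ∫⁻ y, A.indicator (fun z => M.prodKernel T z A') (T.prodRun (runOfJumps y) n)
        ∂M.jumpMeasure := by
  have := isProbabilityMeasure_init_map M
  have hΦ := measurable_historyState T n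
  let D : Set ((Finset.Iic n → S × ℝ≥0) × (S × ℝ≥0)) :=
    {p | historyState T n p.1 ∈ A ∧ T.move (historyState T n p.1) p.2 ∈ A'}
  have hD : MeasurableSet D := by
    refine MeasurableSet.inter (hΦ.comp measurable_fst hA) ?_
    exact T.measurable_move.comp ((hΦ.comp measurable_fst).prodMk measurable_snd) hA'
  have hpre : {y | T.prodRun (runOfJumps y) n ∈ A ∧ T.prodRun (runOfJumps y) (n + 1) ∈ A'} =
      (fun y : ℕ → S × ℝ≥0 => (Preorder.frestrictLe (π := fun _ => S × ℝ≥0) n y,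
        y (n + 1))) ⁻¹' D := by
    ext y
    simp only [Set.mem_ofPred_eq, Set.mem_preimage, D, prodRun_runOfJumps]
    rfl
  rw [hpre, ← Measure.map_apply (by fun_prop) hD, jumpMeasure_eq_trajMeasure,
    ← Kernel.map_frestrictLe_trajMeasure_compProd_eq_map_trajMeasure,
    Measure.compProd_apply hD,
    lintegral_map (Kernel.measurable_kernel_prodMk_left hD) (by fun_prop)]
  refine lintegral_congr fun y => ?_
  rw [prodRun_runOfJumps, Kernel.comap_apply]
  set h := Preorder.frestrictLe (π := fun _ => S × ℝ≥0) n y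
  by_cases hh : historyState T n h ∈ A
  · rw [Set.indicator_of_mem hh, prodKernel_apply,
      Measure.map_apply (measurable_move_right T _) hA', historyState_fst]
    congr 1
    ext p
    simp [D, hh]
  · rw [Set.indicator_of_notMem hh]
    rw [show Prod.mk h ⁻¹' D = ∅ from Set.eq_empty_of_forall_notMem fun p hp => hh hp.1,
      measure_empty]

theorem map_prodRun_jumpMeasure {s₀ : S} (hinit : M.init = PMF.pure s₀) (n : ℕ) :
    M.jumpMeasure.map (fun y => T.prodRun (runOfJumps y) n) =
      (M.prodKernel T ^ n) (s₀, T.init, 0) := by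
  have hmeas (n : ℕ) := measurable_prodRun_runOfJumps T n
  induction n with
  | zero =>
    rw [pow_zero]
    change _ = Kernel.id _
    have h0 : (fun y => T.prodRun (runOfJumps y) 0) =
        historyState T 0 ∘ Preorder.frestrictLe (π := fun _ => S × ℝ≥0) 0 :=
      funext fun y => prodRun_runOfJumps T y 0
    have h1 := measurable_historyState (S := S) T 0
    rw [Kernel.id_apply, h0, ← Measure.map_map h1 (by fun_prop), jumpMeasure,
      Measure.map_comp _ _ (by fun_prop), Kernel.traj_map_frestrictLe, Kernel.partialTraj_self,
      Measure.id_comp, Measure.map_map h1 (by fun_prop), hinit, PMF.toMeasure_pure]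
    exact Measure.map_dirac' (h1.comp (measurable_pi_lambda _ fun _ => by fun_prop)) s₀
  | succ n ih =>
    ext A hA
    rw [Measure.map_apply (hmeas _) hA, Kernel.pow_succ_apply_eq_lintegral _ _ _ hA, ← ih,
      lintegral_map ((M.prodKernel T).measurable_coe hA) (hmeas n)]
    have := jumpMeasure_prodRun_mem_and_succ_mem M T n MeasurableSet.univ hA
    simp only [Set.mem_univ, true_and, Set.indicator_univ] at this
    exact this

theorem IsClosedUnderEdges.ae_prodRun_mem {A : Set (M.RegionVertex T)}
    (hA : M.IsClosedUnderEdges T A) : ∀ᵐ y ∂M.jumpMeasure, ∀ n m, n ≤ m →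
      T.prodRun (runOfJumps y) n ∈ M.statesOf T A →
        T.prodRun (runOfJumps y) m ∈ M.statesOf T A := by
  have hm := measurableSet_statesOf M T A
  have h : ∀ᵐ y ∂M.jumpMeasure, ∀ n, T.prodRun (runOfJumps y) n ∈ M.statesOf T A →
      T.prodRun (runOfJumps y) (n + 1) ∈ M.statesOf T A := by
    refine ae_all_iff.2 fun n => ?_
    rw [ae_iff]
    have := jumpMeasure_prodRun_mem_and_succ_mem M T n hm hm.compl
    simp only [Classical.not_imp]
    refine this.trans ((lintegral_eq_zero_iff' ?_).2 (.of_forall fun y => ?_))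
    · exact ((((M.prodKernel T).measurable_coe hm.compl).indicator hm).comp
        (measurable_prodRun_runOfJumps T n)).aemeasurable
    · exact Set.indicator_apply_eq_zero.2 fun h => hA.prodKernel_compl h
  filter_upwards [h] with y hy n m hnm hn
  induction m, hnm using Nat.le_induction with
  | base => exact hn
  | succ m _ ih => exact hy m ih

/-! ### Bottom vertices and the reduction to the probability of missing them -/

/-- The vertices of the bottom strongly connected components. -/
def bottomVertices : Set (M.RegionVertex T) :=
  {R | ∀ R', Relation.ReflTransGen (M.RegionEdge T) R R' →
    Relation.ReflTransGen (M.RegionEdge T) R' R}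

theorem isClosedUnderEdges_bottomVertices :
    M.IsClosedUnderEdges T (M.bottomVertices T) := fun _ hR _ hRR' R'' h =>
  (hR R'' (h.head hRR')).tail hRR'

variable {M T}

theorem IsClosedUnderEdges.mem_of_reflTransGen {A : Set (M.RegionVertex T)}
    (hA : M.IsClosedUnderEdges T A) {R R' : M.RegionVertex T} (hR : R ∈ A)
    (h : Relation.ReflTransGen (M.RegionEdge T) R R') : R' ∈ A := by
  induction h with
  | refl => exact hR
  | tail _ h ih => exact hA _ ih _ h

/-- From a bottom vertex every edge can be undone by a path, and such a path cannot leave C. -/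
theorem IsBSCC.isClosedUnderEdges_diff {C : Set (M.RegionVertex T)} (hC : M.IsBSCC T C) :
    M.IsClosedUnderEdges T (M.bottomVertices T \ C) := fun R hR R' h =>
  ⟨isClosedUnderEdges_bottomVertices M T R hR.1 R' h, fun hR' => hR.2 <|
    IsClosedUnderEdges.mem_of_reflTransGen hC.closed hR' (hR.1 R' (.single h))⟩

/-- Suppose that C is visited at time n and that at time i the run is in a bottom vertex outside C.
If n ≤ i, closedness of C is violated; if i ≤ n, closedness of the bottom vertices outside C is. So
almost every run that visits C is, at time i, in C or outside the bottom vertices. -/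
theorem IsBSCC.runMeasure_sub_le {C : Set (M.RegionVertex T)} (hC : M.IsBSCC T C) {s₀ : S}
    (hinit : M.init = PMF.pure s₀) (i : ℕ) :
    M.runMeasure.real (M.runsReaching T C) -
        ((M.prodKernel T ^ i) (s₀, T.init, 0)).real (M.statesOf T C) ≤
      ((M.prodKernel T ^ i) (s₀, T.init, 0)).real (M.statesOf T (M.bottomVertices T))ᶜ := by
  have hCm := measurableSet_statesOf M T C
  have hUm := (measurableSet_statesOf M T (M.bottomVertices T)).compl
  have hrm : MeasurableSet (M.runsReaching T C) := by
    have : M.runsReaching T C = ⋃ n, (fun σ => T.prodRun σ n) ⁻¹' M.statesOf T C := by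
      ext σ; simp [runsReaching]
    rw [this]
    exact MeasurableSet.iUnion fun n => measurable_prodRun T n hCm
  have hi := measurable_prodRun_runOfJumps T i
  rw [sub_le_iff_le_add, ← map_prodRun_jumpMeasure M T hinit i, map_measureReal_apply hi hCm,
    map_measureReal_apply hi hUm, runMeasure]
  change (M.jumpMeasure.map runOfJumps).real _ ≤ _
  rw [map_measureReal_apply measurable_runOfJumps hrm]
  refine le_trans ?_ (measureReal_union_le _ _)
  refine ENNReal.toReal_mono (measure_ne_top _ _) (measure_mono_ae ?_)
  filter_upwards [IsClosedUnderEdges.ae_prodRun_mem M T hC.closed,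
    IsClosedUnderEdges.ae_prodRun_mem M T hC.isClosedUnderEdges_diff] with y h1 h2
  rintro ⟨n, hn⟩
  by_contra hcon
  obtain ⟨hcon1, hcon2⟩ := not_or.1 hcon
  obtain ⟨R, hR, hzR⟩ := (mem_statesOf M T).1 (not_not.1 hcon1)
  by_cases hRC : R ∈ C
  · exact hcon2 ((mem_statesOf M T).2 ⟨R, hRC, hzR⟩)
  rcases le_total n i with hni | hni
  · exact hcon2 (h1 n i hni hn)
  · obtain ⟨R', hR', hzR'⟩ := (mem_statesOf M T).1
      (h2 i n hni ((mem_statesOf M T).2 ⟨R, ⟨hR, hRC⟩, hzR⟩))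
    obtain ⟨R'', hR'', hzR''⟩ := (mem_statesOf M T).1 hn
    rw [Subtype.ext (hzR'.symm.trans hzR'')] at hR'
    exact hR'.2 hR''

end SMP

/-! ### Perturbations of reset times -/

/-- The number of elements of `F` whose fractional part is smaller than that of `a`. -/
noncomputable def fractRank (F : Set ℝ) (a : ℝ) : ℕ := {b ∈ F | Int.fract b < Int.fract a}.ncard

/-- The left end point of the window of `a`. -/
noncomputable def windowLeft (F : Set ℝ) (w a : ℝ) : ℝ := ⌊a⌋ + w * fractRank F a

/-- The map `φ` moves the points of `F` into windows of length `w` that are ordered like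
the fractional parts, and it fixes the points of `O`. -/
def IsPerturbation (F : Set ℝ) (w : ℝ) (O : Set ℝ) (φ : ℝ → ℝ) : Prop :=
  (∀ a ∈ F, φ a ∈ Set.Ioo (windowLeft F w a) (windowLeft F w a + w)) ∧ ∀ a ∈ O, φ a = a

section Perturbation

variable {F O : Set ℝ} {w : ℝ} {φ : ℝ → ℝ}

theorem IsPerturbation.update (h : IsPerturbation F w O φ) {a y : ℝ} (ha : a ∉ O)
    (hy : y ∈ Set.Ioo (windowLeft F w a) (windowLeft F w a + w)) :
    IsPerturbation F w O (Function.update φ a y) := by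
  refine ⟨fun b hb => ?_, fun b hb => ?_⟩
  · by_cases hba : b = a
    · rwa [hba, Function.update_self]
    · rw [Function.update_of_ne hba]
      exact h.1 b hb
  · rw [Function.update_of_ne (fun h => ha (h ▸ hb) : b ≠ a)]
    exact h.2 b hb

open Classical in
theorem exists_isPerturbation (hw : 0 < w) (hFO : Disjoint F O) : ∃ φ, IsPerturbation F w O φ := by
  refine ⟨fun a => if a ∈ F then windowLeft F w a + w / 2 else a, fun a ha => ?_, fun a ha => ?_⟩
  · simp only [ha, if_true]
    constructor <;> linarith
  · simp only [hFO.notMem_of_mem_right ha, if_false]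

theorem fractRank_lt_ncard (hF : F.Finite) {a : ℝ} (ha : a ∈ F) : fractRank F a < F.ncard :=
  Set.ncard_lt_ncard ⟨Set.sep_subset _ _, fun h => lt_irrefl _ (h ha).2⟩ hF

theorem fractRank_lt_fractRank (hF : F.Finite) {a b : ℝ} (ha : a ∈ F)
    (hab : Int.fract a < Int.fract b) : fractRank F a < fractRank F b :=
  Set.ncard_lt_ncard ⟨fun _ hc => ⟨hc.1, hc.2.trans hab⟩, fun h => lt_irrefl _ (h ⟨ha, hab⟩).2⟩
    (hF.subset (Set.sep_subset _ _))

/-- Ranks are below the cardinality of F, so all windows, taken modulo 1, fit into (0, g). -/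
theorem IsPerturbation.floor_eq_and_fract_mem (h : IsPerturbation F w O φ) (hF : F.Finite)
    (hw : 0 < w) {g : ℝ} (hg : w * F.ncard ≤ g) (hg1 : g ≤ 1) {a : ℝ} (ha : a ∈ F) :
    ⌊φ a⌋ = ⌊a⌋ ∧ w * fractRank F a < Int.fract (φ a) ∧
      Int.fract (φ a) < w * (fractRank F a + 1) ∧ Int.fract (φ a) < g := by
  obtain ⟨h1, h2⟩ := h.1 a ha
  have hr : ((fractRank F a : ℝ) + 1) ≤ F.ncard := by exact_mod_cast fractRank_lt_ncard hF ha
  have hr' := mul_le_mul_of_nonneg_left hr hw.le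
  have hr0 : 0 ≤ w * (fractRank F a : ℝ) := by positivity
  rw [windowLeft] at h1 h2
  have hfl : ⌊φ a⌋ = ⌊a⌋ := Int.floor_eq_iff.2 ⟨by linarith, by linarith⟩
  rw [Int.fract, hfl]
  refine ⟨rfl, ?_, ?_, ?_⟩ <;> linarith

theorem IsPerturbation.patternOn (h : IsPerturbation F w O φ) (hF : F.Finite) (hw : 0 < w)
    (hwF : w * F.ncard ≤ 1) (hinj : Set.InjOn Int.fract F) : PatternOn φ F := by
  have key {a b : ℝ} (ha : a ∈ F) (hb : b ∈ F) (hab : Int.fract a < Int.fract b) :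
      Int.fract (φ a) < Int.fract (φ b) := by
    obtain ⟨-, -, h1, -⟩ := h.floor_eq_and_fract_mem hF hw hwF le_rfl ha
    obtain ⟨-, h2, -⟩ := h.floor_eq_and_fract_mem hF hw hwF le_rfl hb
    have h3 : (fractRank F a : ℝ) + 1 ≤ fractRank F b := by
      exact_mod_cast fractRank_lt_fractRank hF ha hab
    exact h1.trans_le ((mul_le_mul_of_nonneg_left h3 hw.le).trans h2.le)
  intro a ha b hb k
  refine le_add_intCast_congr (h.floor_eq_and_fract_mem hF hw hwF le_rfl ha).1.symm
    (h.floor_eq_and_fract_mem hF hw hwF le_rfl hb).1.symm ?_ k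
  rcases lt_trichotomy (Int.fract a) (Int.fract b) with hab | hab | hab
  · exact iff_of_true hab.le (key ha hb hab).le
  · rw [hinj ha hb hab]
    simp
  · exact iff_of_false hab.not_ge (key hb ha hab).not_ge

/-- The fractional parts of F' lie in the gap before and after the perturbation, while those of O
avoid it, so their mutual order cannot change. Points of F outside F' may be moved into the gap from
elsewhere; they are never compared with O. -/
theorem IsPerturbation.patternOn_union (h : IsPerturbation F w O φ) (hF : F.Finite) (hw : 0 < w)
    {g : ℝ} (hg : w * F.ncard ≤ g) (hg1 : g ≤ 1) (hinj : Set.InjOn Int.fract F) {F' : Set ℝ}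
    (hF' : F' ⊆ F) (hF'g : ∀ a ∈ F', Int.fract a ∈ Set.Ioo 0 g)
    (hO : ∀ a ∈ O, Int.fract a ∉ Set.Ioo 0 g) : PatternOn φ (F' ∪ O) := by
  have key {a b : ℝ} (ha : a ∈ F') (hb : b ∈ O) :
      (Int.fract a ≤ Int.fract b ↔ Int.fract (φ a) ≤ Int.fract b) ∧
        (Int.fract b ≤ Int.fract a ↔ Int.fract b ≤ Int.fract (φ a)) := by
    obtain ⟨-, h1, -, h2⟩ := h.floor_eq_and_fract_mem hF hw hg hg1 (hF' ha)
    have h3 : 0 ≤ w * (fractRank F a : ℝ) := by positivity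
    obtain ⟨h4, h5⟩ := hF'g a ha
    rcases (Int.fract_nonneg b).eq_or_lt with h0 | h0
    · rw [← h0]
      exact ⟨iff_of_false h4.not_ge (h3.trans_lt h1).not_ge, iff_of_true h4.le (h3.trans h1.le)⟩
    · have h6 : g ≤ Int.fract b := not_lt.1 fun h' => hO b hb ⟨h0, h'⟩
      exact ⟨iff_of_true (h5.le.trans h6) (h2.le.trans h6),
        iff_of_false (h5.trans_le h6).not_ge (h2.trans_le h6).not_ge⟩
  have hfl {a : ℝ} (ha : a ∈ F') : ⌊a⌋ = ⌊φ a⌋ :=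
    (h.floor_eq_and_fract_mem hF hw hg hg1 (hF' ha)).1.symm
  rintro a (ha | ha) b (hb | hb) k
  · exact h.patternOn hF hw (hg.trans hg1) hinj a (hF' ha) b (hF' hb) k
  · rw [h.2 b hb]
    exact le_add_intCast_congr (hfl ha) rfl (key ha hb).1 k
  · rw [h.2 a ha]
    exact le_add_intCast_congr rfl (hfl hb) (key hb ha).2 k
  · rw [h.2 a ha, h.2 b hb]

end Perturbation

/-- The version of `Shadow` for states. -/
def StateShadow {S Q X : Type*} (B : ℕ) (τ : ℝ) (φ : ℝ → ℝ) (z z' : ProdState S Q X) : Prop :=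
  z'.1 = z.1 ∧ z'.2.1 = z.2.1 ∧ Shadow B τ φ z.2.2 z'.2.2

theorem StateShadow.regionRel {S Q X : Type*} {B : ℕ} {τ : ℝ} {φ : ℝ → ℝ} {z z' : ProdState S Q X}
    {P : Set ℝ} (h : StateShadow B τ φ z z') (hφ : PatternOn φ P) (hτ : τ ∈ P)
    (hz : resetTimes B τ z.2.2 ⊆ P) : RegionRel B z z' := by
  obtain ⟨s, q, ν⟩ := z
  obtain ⟨s', q', ν'⟩ := z'
  obtain ⟨rfl, rfl, h3⟩ := h
  exact h3.regionRel hφ hτ hz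

theorem DTA.resetTimes_move_subset {S Q X : Type*} (T : DTA Q S X) (B : ℕ) (z : ProdState S Q X)
    (τ : ℝ) (p : S × ℝ≥0) :
    resetTimes B (τ + p.2) (T.move z p).2.2 ⊆ insert τ (resetTimes B τ z.2.2) := by
  exact resetTimes_reset_delay_subset _ _

/-! ### Imitating a reference run with probability bounded below -/

namespace SMP

variable {S Q X : Type*} [Fintype S] [MeasurableSpace S] [DiscreteMeasurableSpace S]
  [Finite Q] [MeasurableSpace Q] [DiscreteMeasurableSpace Q] [Finite X]
  {M : SMP S} {T : DTA Q S X}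

theorem pMin_nonneg (M : SMP S) : 0 ≤ M.pMin := by
  refine Real.sInf_nonneg ?_
  rintro _ ⟨s, s', -, rfl⟩
  exact ENNReal.toReal_nonneg

theorem ofReal_pMin_le (M : SMP S) {s s' : S} (h : M.trans s s' ≠ 0) :
    ENNReal.ofReal M.pMin ≤ M.trans s s' := by
  refine ENNReal.ofReal_le_of_le_toReal (csInf_le ⟨0, ?_⟩ ⟨s, s', pos_iff_ne_zero.2 h, rfl⟩)
  rintro _ ⟨s, s', -, rfl⟩
  exact ENNReal.toReal_nonneg

/-- One step of a reference run can be imitated with a probability that is bounded below. -/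
theorem IsDelayBound.mul_le_lintegral_of_stateShadow {cδ : ℝ} (hcδ : M.IsDelayBound T.bMax cδ)
    {w : ℝ} (hw1 : w ≤ 1) {P : Set ℝ} {z : ProdState S Q X} {τ : ℝ}
    (hτ : τ ∈ P) (hz : resetTimes T.bMax τ z.2.2 ⊆ P) {s' : S} {t : ℝ≥0}
    (hs' : M.trans z.1 s' ≠ 0) (ht : M.delay z.1 s' t ≠ 0) (hfr : Int.fract (t : ℝ) ≠ 0)
    (hτt : τ + t ∈ P) {Good : (ℝ → ℝ) → Prop} (hpat : ∀ φ, Good φ → PatternOn φ P) {v : ℝ}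
    (hupd : ∀ φ, Good φ → ∀ y ∈ Set.Ioo v (v + w), Good (Function.update φ (τ + t) y))
    {g : ProdState S Q X → ℝ≥0∞} (hg : Measurable g) {κ : ℝ≥0∞}
    (hκ : ∀ φ, Good φ → ∀ z', StateShadow T.bMax (τ + t) φ (T.move z (s', t)) z' → κ ≤ g z')
    {φ : ℝ → ℝ} (hφ : Good φ) {z' : ProdState S Q X} (hz' : StateShadow T.bMax τ φ z z') :
    ENNReal.ofReal (M.pMin * cδ * w) * κ ≤ ∫⁻ z'', g z'' ∂(M.prodKernel T z') := by
  have hrel := hz'.regionRel (hpat φ hφ) hτ hz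
  obtain ⟨q', Y, hm, hm'⟩ := T.exists_move_eq hrel
  obtain ⟨h1, h2, h3⟩ := hz'
  have ht0 : (0 : ℝ) < t := t.coe_nonneg.lt_of_ne fun h => hfr (by rw [← h, Int.fract_zero])
  have hfl : (⌊(t : ℝ)⌋ : ℝ) < t :=
    (Int.floor_le _).lt_of_ne fun h => hfr (by rw [Int.fract, h, sub_self])
  obtain ⟨hc0, hc⟩ := hcδ
  obtain ⟨hc1, hc2⟩ := hc z.1 s'
  obtain ⟨b, hb, hbt⟩ := (M.isDelayDensity_delay z.1 s').exists_forall_le ht hfr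
  have main {W : Set ℝ} (hW : MeasurableSet W)
      (hle : ENNReal.ofReal (cδ * w) ≤ ∫⁻ u in W, M.delay z.1 s' u)
      (hsh : ∀ u ∈ W, ∃ φ', Good φ' ∧
        StateShadow T.bMax (τ + t) φ' (T.move z (s', t)) (T.move z' (s', u.toNNReal))) :
      ENNReal.ofReal (M.pMin * cδ * w) * κ ≤ ∫⁻ z'', g z'' ∂(M.prodKernel T z') := by
    refine le_trans ?_ (mul_le_lintegral_prodKernel M T z' hg s' hW (κ := κ) fun u hu => ?_)
    · rw [mul_assoc, ENNReal.ofReal_mul M.pMin_nonneg, h1]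
      gcongr
      exact ofReal_pMin_le M hs'
    · obtain ⟨φ', hφ', hsh'⟩ := hsh u hu
      exact hκ φ' hφ' _ hsh'
  -- If the reference delay exceeds the maximal constant, every delay beyond that constant does
  -- equally well: it makes all clocks irrelevant, and φ need not be changed. The mass there is
  -- positive, hence larger than cδ. Otherwise the window of length w is used, on which the density
  -- exceeds cδ.
  rcases le_or_gt (T.bMax : ℤ) ⌊(t : ℝ)⌋ with hB | hB
  · have hB' : (T.bMax : ℝ) ≤ ⌊(t : ℝ)⌋ := by exact_mod_cast hB
    refine main (W := Set.Ioi (T.bMax : ℝ)) measurableSet_Ioi ?_ fun u hu => ⟨φ, hφ, ?_⟩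
    · rw [setLIntegral_congr Ioi_ae_eq_Ici]
      refine (ENNReal.ofReal_le_ofReal (mul_le_of_le_one_right hc0.le hw1)).trans
        (hc2.resolve_right fun h0 => ?_).le
      have h4 : ∫⁻ _ in Set.Icc (⌊(t : ℝ)⌋ : ℝ) (⌊(t : ℝ)⌋ + 1), (b : ℝ≥0∞) ≤
          ∫⁻ u in Set.Ici (T.bMax : ℝ), M.delay z.1 s' u :=
        (setLIntegral_mono' measurableSet_Icc fun u hu => by exact_mod_cast hbt u hu).trans
          (lintegral_mono_set fun u hu => hB'.trans hu.1)
      rw [h0, setLIntegral_const, Real.volume_Icc] at h4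
      simp [hb.ne'] at h4
    · have hu : (T.bMax : ℝ) < u := hu
      rw [hm, hm']
      refine ⟨rfl, rfl, Shadow.reset_delay_of_lt _ _ _ _ _ ?_ ?_⟩
      · exact_mod_cast hB'.trans_lt hfl
      · rw [← NNReal.coe_lt_coe, Real.coe_toNNReal u ((Nat.cast_nonneg _).trans hu.le)]
        exact hu
  · have hB' : (⌊(t : ℝ)⌋ : ℝ) + 1 ≤ T.bMax := by exact_mod_cast hB
    have hfl0 : (0 : ℝ) ≤ ⌊(t : ℝ)⌋ := by exact_mod_cast Int.floor_nonneg.2 t.coe_nonneg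
    have hne : τ ≠ τ + t := by linarith
    -- Only the image of the future time τ + t is changed, so the imitation up to τ stays valid. The
    -- preserved comparisons of τ + t with τ force u into the unit interval of t, which lies in [0,
    -- B] and on which the density does not vanish.
    have hu' : ∀ u ∈ Set.Ioo (v - φ τ) (v - φ τ + w), ∃ φ', Good φ' ∧ (∀ a ≤ τ, φ' a = φ a) ∧
        φ' (τ + t) = φ τ + u ∧ (⌊(t : ℝ)⌋ : ℝ) < u ∧ u < ⌊(t : ℝ)⌋ + 1 := by
      intro u hu
      have hG := hupd φ hφ (φ τ + u) ⟨by linarith [hu.1], by linarith [hu.2]⟩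
      have hpat' := hpat _ hG
      have h4 := hpat'.lt_iff hτ hτt (-⌊(t : ℝ)⌋)
      have h5 := hpat'.lt_iff hτt hτ (⌊(t : ℝ)⌋ + 1)
      rw [Function.update_self, Function.update_of_ne hne] at h4 h5
      push_cast at h4 h5
      refine ⟨_, hG, fun a ha => Function.update_of_ne (by linarith) _ _,
        Function.update_self _ _ _, ?_, ?_⟩
      · linarith [h4.1 (by linarith)]
      · linarith [h5.1 (by linarith [Int.lt_floor_add_one (t : ℝ)])]
    refine main (W := Set.Ioo (v - φ τ) (v - φ τ + w)) measurableSet_Ioo ?_ fun u hu => ?_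
    · calc ENNReal.ofReal (cδ * w)
          = ∫⁻ _ in Set.Ioo (v - φ τ) (v - φ τ + w), ENNReal.ofReal cδ := by
            rw [setLIntegral_const, Real.volume_Ioo, ENNReal.ofReal_mul hc0.le,
              add_sub_cancel_left]
        _ ≤ _ := setLIntegral_mono' measurableSet_Ioo fun u hu => by
            obtain ⟨-, -, -, -, h4, h5⟩ := hu' u hu
            have h6 := (hc1 u ⟨by linarith, by linarith⟩).resolve_right
              (hb.trans_le (hbt u ⟨h4.le, h5.le⟩)).ne'
            exact ENNReal.ofReal_le_of_le_toReal h6.le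
    · obtain ⟨φ', hG, hag, heq, h4, h5⟩ := hu' u hu
      refine ⟨φ', hG, ?_⟩
      rw [hm, hm']
      refine ⟨rfl, rfl, (h3.congr hag).reset_delay (hpat φ' hG) hτ hz Y hτt ?_⟩
      rw [heq, hag τ le_rfl, Real.coe_toNNReal u (by linarith)]

/-! ### Generic paths -/

/-- `GenericPath M T U z τ F k`: from the state `z` at time `τ` the set `U` can be reached in `k`
steps which take place at the times in `F`, whose fractional parts are distinct. -/
inductive GenericPath (M : SMP S) (T : DTA Q S X) (U : Set (ProdState S Q X)) :
    ProdState S Q X → ℝ → Set ℝ → ℕ → Prop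
  | nil {z : ProdState S Q X} {τ : ℝ} (hz : z ∈ U) : GenericPath M T U z τ ∅ 0
  | cons {z : ProdState S Q X} {τ : ℝ} {F : Set ℝ} {k : ℕ} {s' : S} {t : ℝ≥0}
      (hs' : M.trans z.1 s' ≠ 0) (ht : M.delay z.1 s' t ≠ 0) (hfr : Int.fract (t : ℝ) ≠ 0)
      (hpath : GenericPath M T U (T.move z (s', t)) (τ + t) F k)
      (hF : ∀ a ∈ F, Int.fract a ≠ Int.fract (τ + t)) :
      GenericPath M T U z τ (insert (τ + t) F) (k + 1)

theorem GenericPath.facts {U : Set (ProdState S Q X)} {z : ProdState S Q X} {τ : ℝ} {F : Set ℝ}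
    {k : ℕ} (h : GenericPath M T U z τ F k) :
    F.Finite ∧ F.ncard ≤ k ∧ Set.InjOn Int.fract F ∧ ∀ a ∈ F, τ ≤ a := by
  induction h with
  | nil => simp
  | @cons z τ F k s' t hs' ht hfr hpath hF ih =>
    obtain ⟨h1, h2, h3, h4⟩ := ih
    refine ⟨h1.insert _, (Set.ncard_insert_le _ _).trans (by omega), ?_, ?_⟩
    · by_cases hm : τ + t ∈ F
      · rwa [Set.insert_eq_of_mem hm]
      · refine (Set.injOn_insert hm).2 ⟨h3, ?_⟩
        rintro ⟨a, ha, h⟩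
        exact hF a ha h
    · rintro a (rfl | ha)
      · simp
      · linarith [h4 a ha, t.coe_nonneg]

/-- All relevant reset times lie in F, so preserving the pattern on F suffices. The perturbation is
left arbitrary in the induction because each step redefines it at one new time. -/
theorem GenericPath.le_pow {U : Set (ProdState S Q X)} (hU : MeasurableSet U)
    (hUR : ∀ z z', RegionRel T.bMax z z' → z ∈ U → z' ∈ U) {cδ : ℝ}
    (hcδ : M.IsDelayBound T.bMax cδ) {F O : Set ℝ} {w : ℝ} (hF : F.Finite) (hw : 0 < w)
    (hwF : w * F.ncard ≤ 1) (hw1 : w ≤ 1) (hinj : Set.InjOn Int.fract F) (hFO : Disjoint F O)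
    {z : ProdState S Q X} {τ : ℝ} {F' : Set ℝ} {k : ℕ} (h : GenericPath M T U z τ F' k)
    (hF' : F' ⊆ F) (hτ : τ ∈ F) (hz : resetTimes T.bMax τ z.2.2 ⊆ F) {φ : ℝ → ℝ}
    (hφ : IsPerturbation F w O φ) {z' : ProdState S Q X} (hz' : StateShadow T.bMax τ φ z z') :
    ENNReal.ofReal (M.pMin * cδ * w) ^ k ≤ (M.prodKernel T ^ k) z' U := by
  induction h generalizing φ z' with
  | nil hzU =>
    rw [pow_zero, pow_zero]
    change 1 ≤ Kernel.id z' U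
    rw [Kernel.id_apply, Measure.dirac_apply' _ hU, Set.indicator_of_mem, Pi.one_apply]
    exact hUR _ _ (hz'.regionRel (hφ.patternOn hF hw hwF hinj) hτ hz) hzU
  | @cons z τ F' k s' t hs' ht hfr hpath hF'' ih =>
    have hmem : τ + t ∈ F := hF' (Set.mem_insert _ _)
    have hz2 : resetTimes T.bMax (τ + t) (T.move z (s', t)).2.2 ⊆ F :=
      (T.resetTimes_move_subset T.bMax z τ (s', t)).trans (Set.insert_subset hτ hz)
    rw [add_comm k 1, Kernel.pow_add_apply_eq_lintegral _ _ _ _ hU, pow_add, pow_one, pow_one]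
    exact hcδ.mul_le_lintegral_of_stateShadow hw1 hτ hz hs' ht hfr hmem
      (Good := IsPerturbation F w O) (fun φ hφ => hφ.patternOn hF hw hwF hinj)
      (v := windowLeft F w (τ + t))
      (fun φ hφ y hy => hφ.update (hFO.notMem_of_mem_left hmem) hy)
      ((M.prodKernel T ^ k).measurable_coe hU)
      (fun φ hφ z' hz' => ih ((Set.subset_insert _ _).trans hF') hmem hz2 hφ hz') hφ hz'

end SMP

/-! ### Short paths in finite graphs -/

/-- There is a path of length `k` from `v` to `A`. -/
def StepsTo {V : Type*} (r : V → V → Prop) (A : Set V) : ℕ → V → Prop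
  | 0, v => v ∈ A
  | k + 1, v => ∃ v', r v v' ∧ StepsTo r A k v'

theorem exists_stepsTo_of_reflTransGen {V : Type*} {r : V → V → Prop} {A : Set V} {v v' : V}
    (h : Relation.ReflTransGen r v v') (hv' : v' ∈ A) : ∃ k, StepsTo r A k v := by
  induction h using Relation.ReflTransGen.head_induction_on with
  | refl => exact ⟨0, hv'⟩
  | head h _ ih =>
    obtain ⟨k, hk⟩ := ih
    exact ⟨k + 1, _, h, hk⟩

/-- The vertices on a shortest path have pairwise different distances to A. -/
theorem exists_stepsTo_lt_card {V : Type*} [Finite V] {r : V → V → Prop} {A : Set V} {v : V}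
    (h : ∃ k, StepsTo r A k v) : ∃ k < Nat.card V, StepsTo r A k v := by
  classical
  have key (k : ℕ) : ∀ v, StepsTo r A k v → (∀ j < k, ¬ StepsTo r A j v) →
      ∀ i ≤ k, ∃ u, StepsTo r A i u ∧ ∀ j < i, ¬ StepsTo r A j u := by
    induction k with
    | zero =>
      intro v hv hmin i hi
      obtain rfl : i = 0 := by omega
      exact ⟨v, hv, hmin⟩
    | succ k ih =>
      intro v hv hmin i hi
      rcases hi.eq_or_lt with rfl | hi
      · exact ⟨v, hv, hmin⟩
      · obtain ⟨v', hvv', hv'⟩ := hv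
        exact ih v' hv' (fun j hj h => hmin (j + 1) (by omega) ⟨v', hvv', h⟩) i (by omega)
  let k := Nat.find h
  choose u hu1 hu2 using key k v (Nat.find_spec h) fun j hj => Nat.find_min h hj
  refine ⟨k, ?_, Nat.find_spec h⟩
  let e : Fin (k + 1) → V := fun i => u i (by omega)
  have he : Function.Injective e := by
    intro i j hij
    have h1 := hu1 i (by omega)
    have h2 := hu2 i (by omega)
    have h3 := hu1 j (by omega)
    have h4 := hu2 j (by omega)
    change u i _ = u j _ at hij
    rw [hij] at h1 h2
    refine Fin.ext (le_antisymm ?_ ?_)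
    · exact not_lt.1 fun hlt => h2 _ hlt h3
    · exact not_lt.1 fun hlt => h4 _ hlt h1
  have := Nat.card_le_card_of_injective e he
  rw [Nat.card_fin] at this
  omega

/-- In a finite graph every vertex is connected to a bottom strongly connected component. -/
theorem exists_reflTransGen_bottom {V : Type*} [Finite V] (r : V → V → Prop) (v : V) :
    ∃ v', Relation.ReflTransGen r v v' ∧
      ∀ u, Relation.ReflTransGen r v' u → Relation.ReflTransGen r u v' := by
  let reach (u : V) : Set V := {u' | Relation.ReflTransGen r u u'}
  -- A reachable vertex with fewest successors: whatever it reaches has the same reachable set, and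
  -- so leads back.
  obtain ⟨v', hv', hmin⟩ := Set.exists_min_image (reach v) (fun u => (reach u).ncard)
    (Set.toFinite _) ⟨v, .refl⟩
  refine ⟨v', hv', fun u hu => ?_⟩
  have hsub : reach u ⊆ reach v' := fun u' hu' => hu.trans hu'
  have := Set.eq_of_subset_of_ncard_le hsub (hmin u (hv'.trans hu)) (Set.toFinite _)
  exact (this.symm ▸ Relation.ReflTransGen.refl : v' ∈ reach u)

/-! ### Separated clocks -/

/-- There are `k` relevant clocks with distinct fractional parts. -/
def HasSeparatedClocks {X : Type*} (B k : ℕ) (ν : ClockVal X) : Prop :=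
  ∃ A : Finset X, A.card = k ∧ (∀ x ∈ A, ν x ≤ B) ∧ Set.InjOn (fun x => Int.fract (ν x : ℝ)) A

theorem HasSeparatedClocks.mono {X : Type*} {B k j : ℕ} {ν : ClockVal X}
    (h : HasSeparatedClocks B k ν) (hj : j ≤ k) : HasSeparatedClocks B j ν := by
  obtain ⟨A, rfl, h1, h2⟩ := h
  obtain ⟨A', hA', rfl⟩ := Finset.exists_subset_card_eq hj
  exact ⟨A', rfl, fun x hx => h1 x (hA' hx), h2.mono (Finset.coe_subset.2 hA')⟩

theorem HasSeparatedClocks.of_regionRel {S Q X : Type*} {B k : ℕ} {z z' : ProdState S Q X}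
    (hz : HasSeparatedClocks B k z.2.2) (h : RegionRel B z z') :
    HasSeparatedClocks B k z'.2.2 := by
  obtain ⟨A, hA, h1, h2⟩ := hz
  refine ⟨A, hA, fun x hx => (h.relevant_iff x).1 (h1 x hx), fun x hx y hy hxy => h2 hx hy ?_⟩
  exact le_antisymm ((h.fract_le_iff x y (h1 x hx) (h1 y hy)).2 (le_of_eq hxy))
    ((h.fract_le_iff y x (h1 y hy) (h1 x hx)).2 (le_of_eq hxy.symm))

theorem HasSeparatedClocks.le_one {X : Type*} {B k : ℕ}
    (h : HasSeparatedClocks B k (0 : ClockVal X)) : k ≤ 1 := by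
  obtain ⟨A, rfl, -, h2⟩ := h
  exact Finset.card_le_one.2 fun x hx y hy => h2 hx hy rfl

/-- All clocks that are reset end with the same value, so at most one of them occurs among separated
clocks. The others are merely translated by t, which does not affect whether their fractional parts
are distinct. -/
theorem HasSeparatedClocks.of_reset_delay {X : Type*} {B k : ℕ} {ν : ClockVal X} {Y : Set X}
    {t : ℝ≥0} (h : HasSeparatedClocks B (k + 1) ((ν.reset Y).delay t)) :
    HasSeparatedClocks B k ν := by
  classical
  obtain ⟨A, hA, h1, h2⟩ := h
  let A' := {x ∈ A | x ∉ Y}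
  have hval {x : X} (hx : x ∈ A') : ((ν.reset Y).delay t) x = ν x + t := by
    simp [ClockVal.delay, ClockVal.reset, (Finset.mem_filter.1 hx).2]
  have hA' : HasSeparatedClocks B A'.card ν := by
    refine ⟨A', rfl, fun x hx => ?_, fun x hx y hy hxy => ?_⟩
    · have := h1 x (Finset.mem_filter.1 hx).1
      rw [hval hx] at this
      exact le_self_add.trans this
    · refine h2 (Finset.mem_filter.1 hx).1 (Finset.mem_filter.1 hy).1 ?_
      obtain ⟨m, hm⟩ := Int.fract_eq_fract.1 hxy
      dsimp only
      rw [hval hx, hval hy]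
      push_cast
      exact Int.fract_eq_fract.2 ⟨m, by linarith⟩
  refine hA'.mono ?_
  have hsplit := Finset.card_filter_add_card_filter_not (s := A) (fun x => x ∉ Y)
  have : {x ∈ A | ¬ x ∉ Y}.card ≤ 1 := by
    refine Finset.card_le_one.2 fun x hx y hy => ?_
    obtain ⟨hx1, hx2⟩ := Finset.mem_filter.1 hx
    obtain ⟨hy1, hy2⟩ := Finset.mem_filter.1 hy
    refine h2 hx1 hy1 ?_
    simp [ClockVal.delay, ClockVal.reset, not_not.1 hx2, not_not.1 hy2]
  change k ≤ {x ∈ A | x ∉ Y}.card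
  omega

/-- The circle contains a gap that avoids a given finite set, and that does not start at `0`. -/
theorem exists_fract_gap (F : Finset ℝ) : ∃ i : ℕ, 1 ≤ i ∧ i < F.card + 2 ∧
    ∀ a ∈ F, Int.fract a ∉ Set.Ioo ((i : ℝ) / (F.card + 2)) ((i + 1) / (F.card + 2)) := by
  classical
  let f : ℝ → ℕ := fun a => ⌊Int.fract a * (F.card + 2)⌋₊
  -- Cut the circle into F.card + 2 cells. Even without cell 0 there are more cells than points, so
  -- one is empty.
  obtain ⟨i, hi, hi'⟩ := Finset.exists_mem_notMem_of_card_lt_card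
    (s := F.image f) (t := Finset.Icc 1 (F.card + 1)) (by
      rw [Nat.card_Icc]
      exact Finset.card_image_le.trans_lt (by omega))
  rw [Finset.mem_Icc] at hi
  refine ⟨i, hi.1, by omega, fun a ha h => hi' (Finset.mem_image.2 ⟨a, ha, ?_⟩)⟩
  have hpos : (0 : ℝ) < F.card + 2 := by positivity
  refine (Nat.floor_eq_iff (mul_nonneg (Int.fract_nonneg a) hpos.le)).2 ⟨?_, ?_⟩
  · exact ((div_lt_iff₀ hpos).1 h.1).le
  · exact (lt_div_iff₀ hpos).1 h.2

namespace SMP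

variable {S Q X : Type*} [Fintype S] [MeasurableSpace S] [DiscreteMeasurableSpace S]
  [Finite Q] [MeasurableSpace Q] [DiscreteMeasurableSpace Q] [Finite X]
  {M : SMP S} {T : DTA Q S X}

theorem prodInit_eq_dirac {s₀ : S} (hinit : M.init = PMF.pure s₀) :
    M.prodInit T = Measure.dirac (s₀, T.init, 0) := by
  rw [prodInit, hinit, PMF.toMeasure_pure]
  exact Measure.map_dirac' (by fun_prop) s₀

theorem exists_predecessor {n : ℕ} {R : Region S Q X T.bMax}
    (h : 0 < (M.prodInit T).bind (M.prodKernel T ^ (n + 1)) R.states) :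
    ∃ z, 0 < (M.prodInit T).bind (M.prodKernel T ^ n) (regionOf T z).states ∧
      0 < M.prodKernel T z R.states := by
  have hR := measurableSet_states R
  have := finite_region S Q X T.bMax
  rw [prodInit_bind_pow_succ, Measure.bind_apply hR (Kernel.aemeasurable _)] at h
  by_contra! hcon
  refine h.ne' ((lintegral_eq_zero_iff ((M.prodKernel T).measurable_coe hR)).2 ?_)
  set μ := (M.prodInit T).bind (M.prodKernel T ^ n)
  have hnull : μ (⋃ R' ∈ {R' : Region S Q X T.bMax | μ R'.states = 0}, R'.states) = 0 :=
    (measure_biUnion_null_iff (Set.to_countable _)).2 fun _ h => h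
  filter_upwards [measure_eq_zero_iff_ae_notMem.1 hnull] with z hz
  refine le_antisymm (hcon z (pos_iff_ne_zero.2 fun h0 => hz ?_)) zero_le
  exact Set.mem_iUnion₂.2 ⟨regionOf T z, h0, rfl⟩

/-- Go back along the history. The number of distinct fractional parts drops by at most one per step
and is at most 1 at the start, so no value k ≥ 2 below the final one is skipped. -/
theorem HasSeparatedClocks.exists_regionVertex {s₀ : S} (hinit : M.init = PMF.pure s₀) {n : ℕ} :
    ∀ {z : ProdState S Q X} {k : ℕ},
      0 < (M.prodInit T).bind (M.prodKernel T ^ n) (regionOf T z).states →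
      HasSeparatedClocks T.bMax k z.2.2 → 2 ≤ k →
      ∃ R : M.RegionVertex T, ∃ z', regionOf T z' = R.1 ∧ HasSeparatedClocks T.bMax k z'.2.2 ∧
        ¬ HasSeparatedClocks T.bMax (k + 1) z'.2.2 := by
  induction n with
  | zero =>
    intro z k hz hk h2
    have hR := measurableSet_states (regionOf T z)
    rw [prodInit_eq_dirac hinit, Measure.dirac_bind (Kernel.measurable _), pow_zero] at hz
    change 0 < Kernel.id _ _ at hz
    rw [Kernel.id_apply, Measure.dirac_apply' _ hR] at hz
    have hmem := Set.mem_of_indicator_ne_zero hz.ne'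
    have := (hk.of_regionRel ((regionSetoid S Q X T.bMax).symm (Quotient.exact hmem))).le_one
    omega
  | succ n ih =>
    intro z k hz hk h2
    by_cases hk1 : HasSeparatedClocks T.bMax (k + 1) z.2.2
    · obtain ⟨z', hz', hpos⟩ := exists_predecessor hz
      obtain ⟨s', t, -, -, -, hmem⟩ := exists_move_mem_of_pos M T (measurableSet_states _) hpos
        Set.countable_empty
      refine ih hz' ?_ h2
      have := hk1.of_regionRel ((regionSetoid S Q X T.bMax).symm (Quotient.exact hmem))
      exact this.of_reset_delay
    · exact ⟨⟨_, n + 1, hz⟩, z, rfl, hk, hk1⟩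

/-- The number of distinct fractional parts is an invariant of the region, and each of 2, …, k is
the exact number for some vertex; these are k - 1 different vertices. -/
theorem HasSeparatedClocks.le_card_regionVertex {s₀ : S} (hinit : M.init = PMF.pure s₀)
    (R : M.RegionVertex T) {z : ProdState S Q X} {k : ℕ} (hz : regionOf T z = R.1)
    (hk : HasSeparatedClocks T.bMax k z.2.2) : k ≤ Nat.card (M.RegionVertex T) + 1 := by
  obtain ⟨n, hn⟩ := R.2
  rw [← hz] at hn
  have key (j : Finset.Icc 2 k) := HasSeparatedClocks.exists_regionVertex hinit hn
    (hk.mono (Finset.mem_Icc.1 j.2).2) (Finset.mem_Icc.1 j.2).1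
  choose f u hu1 hu2 hu3 using key
  have hf : Function.Injective f := by
    intro i j hij
    have hrel : RegionRel T.bMax (u i) (u j) := Quotient.exact ((hu1 i).trans (hij ▸ (hu1 j).symm))
    refine Subtype.ext (le_antisymm ?_ ?_)
    · refine not_lt.1 fun hlt => hu3 j (((hu2 i).of_regionRel hrel).mono hlt)
    · refine not_lt.1 fun hlt => hu3 i (((hu2 j).of_regionRel
        ((regionSetoid S Q X T.bMax).symm hrel)).mono hlt)
  have := Nat.card_le_card_of_injective f hf
  rw [Nat.card_eq_fintype_card, Fintype.card_coe, Nat.card_Icc] at this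
  omega

/-- A path in the region graph lifts to a generic path of the product process. -/
theorem exists_genericPath {A : Set (M.RegionVertex T)} {k : ℕ} :
    ∀ {R : M.RegionVertex T}, StepsTo (M.RegionEdge T) A k R → ∀ {z : ProdState S Q X},
      regionOf T z = R.1 → ∀ (τ : ℝ) {H : Set ℝ}, H.Countable →
      ∃ F, GenericPath M T (M.statesOf T A) z τ F k ∧
        ∀ a ∈ F, ∀ b ∈ H, Int.fract a ≠ Int.fract b := by
  induction k with
  | zero =>
    intro R hR z hz τ H _
    exact ⟨∅, .nil ((mem_statesOf M T).2 ⟨R, hR, hz⟩), by simp⟩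
  | succ k ih =>
    rintro R ⟨R', ⟨z', hz', hpos⟩, hR'⟩ z hz τ H hH
    -- The edge is moved to the given state; its delay then avoids the countably many values at
    -- which the delay is an integer or the new time meets a fractional part from H.
    have hpos' := prodKernel_pos_congr M T (Quotient.exact (hz'.trans hz.symm)) hpos
    have hN1 := countable_fract_sub_eq_zero (Set.countable_singleton (0 : ℝ)) 0
    have hN2 := countable_fract_sub_eq_zero hH τ
    obtain ⟨s', t, hs', ht, htN, hmem⟩ := exists_move_mem_of_pos M T (measurableSet_states R'.1)
      hpos' (hN1.union hN2)
    have hfr : Int.fract (t : ℝ) ≠ 0 := fun h => htN (.inl ⟨0, rfl, by simpa using h⟩)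
    obtain ⟨F, hF, hFH⟩ := ih hR' hmem (τ + t) (hH.insert (τ + t))
    refine ⟨insert (τ + t) F, .cons hs' ht hfr hF fun a ha => hFH a ha _ (Set.mem_insert _ _), ?_⟩
    rintro a (rfl | ha) b hb
    · intro h
      obtain ⟨m, hm⟩ := Int.fract_eq_fract.1 h
      exact htN (.inr ⟨b, hb, by rw [hm, Int.fract_intCast]⟩)
    · exact hFH a ha b (Set.mem_insert_of_mem _ hb)

end SMP

/-! ### Descending runs -/

/-- Outside the gap the fractional part of b is either 0 or at least g, so the borrow in the
subtraction depends on b alone. As a moves through times in the gap, the integral part of a - b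
follows that of a. -/
theorem floor_sub_eq {a b g : ℝ} (ha : Int.fract a ∈ Set.Ioo 0 g) (hb : Int.fract b ∉ Set.Ioo 0 g) :
    ⌊a - b⌋ = ⌊a⌋ - ⌊b⌋ - if Int.fract b = 0 then 0 else 1 := by
  have h1 := Int.floor_add_fract a
  have h2 := Int.floor_add_fract b
  have h3 := Int.fract_lt_one a
  have h4 := Int.fract_lt_one b
  rw [Int.floor_eq_iff]
  split_ifs with h
  · push_cast
    constructor <;> linarith [ha.1]
  · have h5 : 0 < Int.fract b := (Int.fract_nonneg b).lt_of_ne' h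
    have h6 : g ≤ Int.fract b := not_lt.1 fun h' => hb ⟨h5, h'⟩
    push_cast
    constructor <;> linarith [ha.1, ha.2]

namespace SMP

variable {S Q X : Type*} [Fintype S] [MeasurableSpace S] [DiscreteMeasurableSpace S]
  [Finite Q] [MeasurableSpace Q] [DiscreteMeasurableSpace Q] [Finite X]
  {M : SMP S} {T : DTA Q S X}

/-- One step of a run, from the state `a.1` at time `a.2`, in which the fractional part of the time
decreases, but stays positive, while its integral part increases. -/
def DescentStep (M : SMP S) (T : DTA Q S X) (g : ℝ) (a b : ProdState S Q X × ℝ) : Prop :=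
  ∃ (s' : S) (t : ℝ≥0), M.trans a.1.1 s' ≠ 0 ∧ M.delay a.1.1 s' t ≠ 0 ∧ Int.fract (t : ℝ) ≠ 0 ∧
    b = (T.move a.1 (s', t), a.2 + t) ∧ Int.fract b.2 ∈ Set.Ioo 0 g ∧
    Int.fract b.2 < Int.fract a.2 ∧ ⌊a.2⌋ + 1 ≤ ⌊b.2⌋

theorem exists_descentStep {g : ℝ} (hg : 0 < g) (a : ProdState S Q X × ℝ)
    (ha : 0 < Int.fract a.2) : ∃ b, DescentStep M T g a b := by
  obtain ⟨s', hs'⟩ := (M.trans a.1.1).support_nonempty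
  obtain ⟨l, hl⟩ := (M.isDelayDensity_delay a.1.1 s').exists_unit_interval
  set f := Int.fract a.2 with hf
  have hf1 : f < 1 := Int.fract_lt_one _
  set γ := min f g / 2 with hγ
  have hmin : 0 < min f g := lt_min ha hg
  have hγ0 : 0 < γ := by positivity
  have hγf : γ < f := by linarith [min_le_left f g]
  have hγg : γ < g := by linarith [min_le_right f g]
  have hl0 : (0 : ℝ) ≤ l := Nat.cast_nonneg l
  -- Since 0 < γ < f < 1, this delay lies strictly inside [l, l + 1], where the density is positive.
  -- It lowers the fractional part of the time from f to γ and raises the integral part by l + 1.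
  let t : ℝ≥0 := ⟨l + 1 + γ - f, by linarith⟩
  have ht : (t : ℝ) = l + 1 + γ - f := rfl
  have hfl : ⌊a.2⌋ + f = a.2 := Int.floor_add_fract a.2
  have hb : a.2 + t = ((⌊a.2⌋ + l + 1 : ℤ) : ℝ) + γ := by
    rw [ht]
    push_cast
    linarith
  have hfloor : ⌊a.2 + t⌋ = ⌊a.2⌋ + l + 1 := by
    rw [Int.floor_eq_iff, hb]
    constructor <;> linarith
  have hfract : Int.fract (a.2 + t) = γ := by
    rw [Int.fract, hfloor, hb]
    ring
  refine ⟨_, s', t, hs', hl t ⟨by linarith, by linarith⟩, ?_, rfl, ?_, ?_, ?_⟩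
  · intro h
    obtain ⟨m, hm⟩ := Int.fract_eq_zero_iff.1 h
    have h1 : ((l : ℤ) : ℝ) < m := by rw [hm, ht]; push_cast; linarith
    have h2 : (m : ℝ) < ((l + 1 : ℤ) : ℝ) := by rw [hm, ht]; push_cast; linarith
    have h3 : (l : ℤ) < m := by exact_mod_cast h1
    have h4 : m < (l : ℤ) + 1 := by exact_mod_cast h2
    omega
  · exact hfract ▸ ⟨hγ0, hγg⟩
  · exact hfract ▸ hγf
  · dsimp only
    omega

theorem exists_descent {g : ℝ} (hg : 0 < g) (z : ProdState S Q X) {τ : ℝ}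
    (hτ : 0 < Int.fract τ) :
    ∃ u : ℕ → ProdState S Q X × ℝ, u 0 = (z, τ) ∧ ∀ j, DescentStep M T g (u j) (u (j + 1)) := by
  choose f hf using fun a : {a : ProdState S Q X × ℝ // 0 < Int.fract a.2} =>
    exists_descentStep (M := M) (T := T) hg a.1 a.2
  let F (a : {a : ProdState S Q X × ℝ // 0 < Int.fract a.2}) :
      {a : ProdState S Q X × ℝ // 0 < Int.fract a.2} :=
    ⟨f a, by obtain ⟨_, _, -, -, -, -, h, -⟩ := hf a; exact h.1⟩
  refine ⟨fun j => (F^[j] ⟨(z, τ), hτ⟩).1, rfl, fun j => ?_⟩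
  dsimp only
  rw [Function.iterate_succ_apply']
  exact hf _

/-- The time and the reset times of the relevant clocks. -/
def activeTimes {S Q X : Type*} (B : ℕ) (a : ProdState S Q X × ℝ) : Set ℝ :=
  insert a.2 (resetTimes B a.2 a.1.2.2)

section Descent

variable {g : ℝ} {u : ℕ → ProdState S Q X × ℝ}

theorem strictMono_of_descentStep (hu : ∀ j, DescentStep M T g (u j) (u (j + 1))) :
    StrictMono fun j => (u j).2 := by
  refine strictMono_nat_of_lt_succ fun j => ?_
  obtain ⟨_, t, -, -, hfr, h, -⟩ := hu j
  have ht0 : (0 : ℝ) < t := t.coe_nonneg.lt_of_ne fun h => hfr (by rw [← h, Int.fract_zero])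
  rw [h]
  linarith

theorem strictAnti_fract_of_descentStep (hu : ∀ j, DescentStep M T g (u j) (u (j + 1))) :
    StrictAnti fun j => Int.fract (u j).2 := by
  refine strictAnti_nat_of_succ_lt fun j => ?_
  obtain ⟨_, _, -, -, -, -, -, h, -⟩ := hu j
  exact h

theorem strictMono_floor_of_descentStep (hu : ∀ j, DescentStep M T g (u j) (u (j + 1))) :
    StrictMono fun j => ⌊(u j).2⌋ := by
  refine strictMono_nat_of_lt_succ fun j => ?_
  obtain ⟨_, _, -, -, -, -, -, -, h⟩ := hu j
  exact Int.add_one_le_iff.1 h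

theorem fract_mem_of_descentStep (hu : ∀ j, DescentStep M T g (u j) (u (j + 1))) {j : ℕ}
    (hj : 1 ≤ j) : Int.fract (u j).2 ∈ Set.Ioo 0 g := by
  obtain ⟨j, rfl⟩ := Nat.exists_eq_add_of_le' hj
  obtain ⟨_, _, -, -, -, -, h, -⟩ := hu j
  exact h

theorem activeTimes_subset_of_descentStep (hu : ∀ j, DescentStep M T g (u j) (u (j + 1)))
    (B j : ℕ) : activeTimes B (u j) ⊆ (fun i => (u i).2) '' Set.Icc 1 j ∪ activeTimes B (u 0) := by
  induction j with
  | zero => exact Set.subset_union_right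
  | succ j ih =>
    refine Set.insert_subset (.inl ⟨j + 1, ⟨by omega, le_rfl⟩, rfl⟩) ?_
    obtain ⟨s', t, -, -, -, h, -⟩ := hu j
    rw [h]
    refine (T.resetTimes_move_subset B _ _ _).trans (ih.trans (Set.union_subset_union_left _ ?_))
    exact Set.image_mono (Set.Icc_subset_Icc_right j.le_succ)

theorem resetTimes_subset_of_descentStep (hu : ∀ j, DescentStep M T g (u j) (u (j + 1)))
    (B j : ℕ) : resetTimes B (u (j + 1)).2 (u (j + 1)).1.2.2 ⊆
      (fun i => (u i).2) '' Set.Icc 1 j ∪ activeTimes B (u 0) := by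
  obtain ⟨s', t, -, -, -, h, -⟩ := hu j
  rw [h]
  exact (T.resetTimes_move_subset B _ _ _).trans (activeTimes_subset_of_descentStep hu B j)

/-- Each new time has a fractional part in the gap, away from the old reset times, and smaller than
those of the previous steps. Its delay is thus generic, and the region entered is entered with
positive probability. -/
theorem exists_regionVertex_of_descentStep (hu : ∀ j, DescentStep M T g (u j) (u (j + 1)))
    (h0 : ∃ R : M.RegionVertex T, regionOf T (u 0).1 = R.1)
    (hO : ∀ a ∈ activeTimes T.bMax (u 0), Int.fract a ∉ Set.Ioo 0 g) (j : ℕ) :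
    ∃ R : M.RegionVertex T, regionOf T (u j).1 = R.1 := by
  induction j with
  | zero => exact h0
  | succ j ih =>
    obtain ⟨R, hR⟩ := ih
    have hfr1 := fract_mem_of_descentStep hu (Nat.succ_pos j)
    have hanti := strictAnti_fract_of_descentStep hu
    obtain ⟨s', t, hs', ht, -, h, -⟩ := hu j
    have key : ∀ a ∈ activeTimes T.bMax (u j), Int.fract (u (j + 1)).2 ≠ Int.fract a := by
      intro a ha
      rcases activeTimes_subset_of_descentStep hu _ j ha with ⟨i, hi, rfl⟩ | ha
      · exact (hanti (Nat.lt_succ_of_le hi.2)).ne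
      · intro h
        exact hO a ha (h ▸ hfr1)
    have hpos := prodKernel_pos_of_regionRel M T ((regionSetoid S Q X T.bMax).refl (u j).1) hs' ht
      (by
        rintro ⟨b, hb, hfr⟩
        obtain ⟨m, hm⟩ := Int.fract_eq_zero_iff.1 hfr
        refine key ((u j).2 + b) ?_ (Int.fract_eq_fract.2 ⟨m, ?_⟩)
        · rcases hb with rfl | ⟨x, hx, rfl⟩
          · left
            ring
          · right
            exact ⟨x, hx, by ring⟩
        · rw [h]
          dsimp only
          linarith)
    have hv := exists_bind_pow_pos_of_prodKernel_pos M T R hR hpos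
    exact ⟨⟨_, hv⟩, by rw [h]⟩

/-- A clock that stays relevant is reset in the course of a descent that is longer than the number
of regions. -/
theorem resetTimes_subset_image_of_descentStep
    (hu : ∀ j, DescentStep M T g (u j) (u (j + 1)))
    (h0 : ∃ R : M.RegionVertex T, regionOf T (u 0).1 = R.1)
    (hO : ∀ a ∈ activeTimes T.bMax (u 0), Int.fract a ∉ Set.Ioo 0 g) {n : ℕ}
    (hn : Nat.card (M.RegionVertex T) ≤ n) :
    resetTimes T.bMax (u (n + 1)).2 (u (n + 1)).1.2.2 ⊆ (fun i => (u i).2) '' Set.Icc 1 n := by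
  intro r hr
  refine (resetTimes_subset_of_descentStep hu T.bMax n hr).resolve_right fun hrO => ?_
  have hfr := hO r hrO
  have hmono := strictMono_of_descentStep hu
  have hr0 : r ≤ (u 0).2 := by
    rcases hrO with rfl | hrO
    · exact le_rfl
    · exact resetTimes_le hrO
  obtain ⟨x, hx, hxr⟩ := hr
  -- Backwards from the last state to `u 1`: a reset of x at a step from `u i` with i ≥ 1 would give
  -- it a reset time later than that of `u 0`, whereas r is not later.
  have key (d : ℕ) (hd : d ≤ n) : (u (n + 1 - d)).1.2.2 x ≤ T.bMax ∧
      r = (u (n + 1 - d)).2 - (u (n + 1 - d)).1.2.2 x := by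
    induction d with
    | zero => exact ⟨hx, hxr⟩
    | succ d ih =>
      obtain ⟨h1, h2⟩ := ih (by omega)
      obtain ⟨i, hi⟩ : ∃ i, n + 1 - d = i + 1 ∧ n + 1 - (d + 1) = i ∧ 1 ≤ i := ⟨n - d, by omega⟩
      rw [hi.1] at h1 h2
      rw [hi.2.1]
      obtain ⟨s', t, -, -, -, h, -⟩ := hu i
      obtain ⟨q', Y, hm, -⟩ := T.exists_move_eq ((regionSetoid S Q X T.bMax).refl (u i).1)
      rw [h, hm] at h1 h2
      simp only [ClockVal.delay, ClockVal.reset] at h1 h2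
      by_cases hxY : x ∈ Y
      · simp only [hxY, if_true, zero_add] at h2
        have : (u 0).2 < (u i).2 := hmono (by omega)
        linarith
      · simp only [hxY, if_false] at h1 h2
        push_cast at h2
        exact ⟨le_self_add.trans h1, by linarith⟩
  choose R hR using exists_regionVertex_of_descentStep hu h0 hO
  -- The integral part of the clock x determines that of the time, which increases strictly. So n +
  -- 1 states lie in different regions, too many for the vertices available.
  have hinj : Function.Injective fun i : Fin (n + 1) => R (i + 1) := by
    intro i j hij
    have hrel : RegionRel T.bMax (u (i + 1)).1 (u (j + 1)).1 :=
      Quotient.exact ((hR _).trans ((congrArg Subtype.val hij).trans (hR _).symm))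
    have hi := key (n - i) (by omega)
    have hj := key (n - j) (by omega)
    rw [show n + 1 - (n - i) = i + 1 by omega] at hi
    rw [show n + 1 - (n - j) = j + 1 by omega] at hj
    have h3 := (hrel.agree x hi.1).1
    rw [show ((u (i + 1)).1.2.2 x : ℝ) = (u (i + 1)).2 - r by linarith [hi.2],
      show ((u (j + 1)).1.2.2 x : ℝ) = (u (j + 1)).2 - r by linarith [hj.2],
      floor_sub_eq (fract_mem_of_descentStep hu (by omega)) hfr,
      floor_sub_eq (fract_mem_of_descentStep hu (by omega)) hfr] at h3
    have h4 : ⌊(u (i + 1)).2⌋ = ⌊(u (j + 1)).2⌋ := by linarith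
    have h5 := (strictMono_floor_of_descentStep hu).injective h4
    exact Fin.ext (by omega)
  have := Nat.card_le_card_of_injective _ hinj
  rw [Nat.card_fin] at this
  omega

end Descent

/-! ### The gap and the uniform probability of reaching a bottom vertex -/

/-- A gap between the reset times of the relevant clocks of a reachable state. -/
theorem exists_gap {s₀ : S} (hinit : M.init = PMF.pure s₀) (R : M.RegionVertex T)
    {z : ProdState S Q X} (hz : regionOf T z = R.1) :
    ∃ τ g : ℝ, 0 < g ∧ g ≤ 1 ∧ 1 ≤ g * (Nat.card (M.RegionVertex T) + 3) ∧ 0 < Int.fract τ ∧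
      ∀ a ∈ activeTimes T.bMax (z, τ), Int.fract a ∉ Set.Ioo 0 g := by
  classical
  have := Fintype.ofFinite X
  let f : X → ℝ := fun x => Int.fract (-(z.2.2 x : ℝ))
  let F : Finset ℝ := (Finset.univ.filter fun x => z.2.2 x ≤ T.bMax).image f
  have hF : F.card ≤ Nat.card (M.RegionVertex T) + 1 := by
    obtain ⟨A, hA, hinj, himg⟩ := Finset.exists_subset_injOn_image_eq_of_surjOn (f := f)
      {x | z.2.2 x ≤ T.bMax} F (by
        intro a ha
        obtain ⟨x, hx, rfl⟩ := Finset.mem_image.1 (Finset.mem_coe.1 ha)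
        exact ⟨x, (Finset.mem_filter.1 hx).2, rfl⟩)
    rw [← himg, Finset.card_image_of_injOn hinj]
    refine HasSeparatedClocks.le_card_regionVertex hinit R hz ⟨A, rfl, fun x hx => hA hx, ?_⟩
    intro x hx y hy hxy
    obtain ⟨m, hm⟩ := Int.fract_eq_fract.1 hxy
    refine hinj hx hy (Int.fract_eq_fract.2 ⟨-m, ?_⟩)
    push_cast
    linarith
  obtain ⟨i, hi1, hi2, hi⟩ := exists_fract_gap F
  have hcard : (0 : ℝ) < F.card + 2 := by positivity
  set g : ℝ := 1 / (F.card + 2) with hg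
  have hg0 : 0 < g := by positivity
  have hmul : g * (F.card + 2) = 1 := by rw [hg]; field_simp
  have hi1' : (1 : ℝ) ≤ i := by exact_mod_cast hi1
  have hi2' : (i : ℝ) + 1 ≤ F.card + 2 := by exact_mod_cast hi2
  have h1 : g ≤ i * g := le_mul_of_one_le_left hg0.le hi1'
  have h2 : (i + 1) * g ≤ 1 := by
    have := mul_le_mul_of_nonneg_left hi2' hg0.le
    linarith
  have hfr : Int.fract (1 - i * g) = 1 - i * g :=
    Int.fract_eq_self.2 ⟨by linarith, by linarith⟩
  -- This origin of time turns the empty cell (i g, (i + 1) g) into (0, g). As i ≥ 1, the time is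
  -- not an integer, and as (i + 1) g ≤ 1, its own fractional part is at least g.
  refine ⟨1 - i * g, g, hg0, by linarith, ?_, by rw [hfr]; linarith, ?_⟩
  · rw [← hmul]
    refine mul_le_mul_of_nonneg_left ?_ hg0.le
    have : (F.card : ℝ) ≤ Nat.card (M.RegionVertex T) + 1 := by exact_mod_cast hF
    linarith
  · rintro _ (rfl | ⟨x, hx, rfl⟩) ⟨h3, h4⟩
    · dsimp only at h3 h4
      rw [hfr] at h4
      linarith
    · dsimp only at hx h3 h4
      refine hi (f x) (Finset.mem_image_of_mem _ (Finset.mem_filter.2 ⟨Finset.mem_univ _, hx⟩)) ?_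
      have h5 := Int.floor_add_fract (1 - i * g - (z.2.2 x : ℝ))
      set e := Int.fract (1 - i * g - (z.2.2 x : ℝ))
      have h6 : Int.fract (f x) = i * g + e := by
        rw [Int.fract_fract, Int.fract_eq_iff]
        refine ⟨by linarith, by linarith, ⌊1 - i * g - (z.2.2 x : ℝ)⌋ - 1, ?_⟩
        push_cast
        linarith
      rw [h6, div_eq_mul_one_div, ← hg, div_eq_mul_one_div, ← hg]
      constructor <;> linarith

/-- The probability to reach a bottom strongly connected component from a reachable region. -/
theorem exists_le_pow_bottomVertices {s₀ : S} (hinit : M.init = PMF.pure s₀) {cδ : ℝ}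
    (hcδ : M.IsDelayBound T.bMax cδ) (R : M.RegionVertex T) {z : ProdState S Q X}
    (hz : regionOf T z = R.1) {n : ℕ} (hn : n = Nat.card (M.RegionVertex T)) :
    ∃ N ≤ 2 * n, ENNReal.ofReal (M.pMin * cδ * (1 / (2 * n * (n + 3)))) ^ N ≤
      (M.prodKernel T ^ N) z (M.statesOf T (M.bottomVertices T)) := by
  have hn1 : 1 ≤ n := hn ▸ Nat.one_le_iff_ne_zero.2 (Nat.card_ne_zero.2 ⟨⟨R⟩, inferInstance⟩)
  have hn1' : (1 : ℝ) ≤ n := by exact_mod_cast hn1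
  obtain ⟨τ, g, hg0, hg1, hgn, hτ, hO⟩ := exists_gap hinit R hz
  rw [← hn] at hgn
  obtain ⟨u, hu0, hu⟩ := exists_descent (M := M) (T := T) hg0 z hτ
  have h0 : ∃ R : M.RegionVertex T, regionOf T (u 0).1 = R.1 := ⟨R, by rw [hu0, hz]⟩
  rw [← hu0] at hO
  set O := activeTimes T.bMax (u 0)
  set U := M.statesOf T (M.bottomVertices T)
  have hUm : MeasurableSet U := measurableSet_statesOf M T _
  obtain ⟨R₁, hR₁⟩ := exists_regionVertex_of_descentStep hu h0 hO (n + 1)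
  obtain ⟨R₂, hR₁₂, hR₂⟩ := exists_reflTransGen_bottom (M.RegionEdge T) R₁
  obtain ⟨k, hk, hsteps⟩ := exists_stepsTo_lt_card (exists_stepsTo_of_reflTransGen
    (A := M.bottomVertices T) hR₁₂ hR₂)
  let F₁ : Set ℝ := (fun i => (u i).2) '' Set.Icc 1 (n + 1)
  have hF₁ : F₁.Finite := (Set.finite_Icc _ _).image _
  obtain ⟨F₂, hF₂, hF₁₂⟩ := exists_genericPath hsteps hR₁ (u (n + 1)).2 hF₁.countable
  obtain ⟨hF₂fin, hF₂card, hF₂inj, hF₂le⟩ := hF₂.facts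
  have hmono := strictMono_of_descentStep hu
  have hanti := strictAnti_fract_of_descentStep hu
  have hF₁g : ∀ a ∈ F₁, Int.fract a ∈ Set.Ioo 0 g := by
    rintro _ ⟨i, hi, rfl⟩
    exact fract_mem_of_descentStep hu hi.1
  have hFfin : (F₁ ∪ F₂).Finite := hF₁.union hF₂fin
  -- There are n + 1 times from the descent and at most n - 1 from the path.
  have hFcard : (F₁ ∪ F₂).ncard ≤ 2 * n := by
    have h1 : F₁.ncard ≤ n + 1 := by
      refine (Set.ncard_image_le (Set.finite_Icc _ _)).trans ?_
      rw [← Nat.card_coe_set_eq, Nat.card_eq_fintype_card, Fintype.card_ofFinset, Nat.card_Icc]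
      omega
    have := Set.ncard_union_le F₁ F₂
    omega
  have hinj : Set.InjOn Int.fract (F₁ ∪ F₂) := by
    rintro a (⟨i, hi, rfl⟩ | ha) b (⟨j, hj, rfl⟩ | hb) hab
    · dsimp only at hab ⊢
      rw [hanti.injective hab]
    · exact absurd hab.symm (hF₁₂ b hb _ ⟨i, hi, rfl⟩)
    · exact absurd hab (hF₁₂ a ha _ ⟨j, hj, rfl⟩)
    · exact hF₂inj ha hb hab
  have hOle : ∀ a ∈ O, a ≤ (u 0).2 := by
    rintro a (rfl | ha)
    · exact le_rfl
    · exact resetTimes_le ha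
  have hFO : Disjoint (F₁ ∪ F₂) O := by
    refine Set.disjoint_left.2 fun a ha haO => (hOle a haO).not_gt ?_
    rcases ha with ⟨i, hi, rfl⟩ | ha
    · exact hmono (Nat.lt_of_lt_of_le Nat.zero_lt_one hi.1)
    · exact (hmono n.succ_pos).trans_le (hF₂le a ha)
  set w : ℝ := 1 / (2 * n * (n + 3)) with hw
  have hw0 : 0 < w := by positivity
  have hwg : w * (F₁ ∪ F₂).ncard ≤ g := by
    have h1 : ((F₁ ∪ F₂).ncard : ℝ) ≤ 2 * n := by exact_mod_cast hFcard
    have h2 : w * (2 * n) = 1 / (n + 3) := by rw [hw]; field_simp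
    refine (mul_le_mul_of_nonneg_left h1 hw0.le).trans (h2.trans_le ?_)
    rwa [div_le_iff₀ (by positivity)]
  have hw1 : w ≤ 1 := by
    rw [hw, div_le_one (by positivity)]
    nlinarith
  have hUR : ∀ z z', RegionRel T.bMax z z' → z ∈ U → z' ∈ U := by
    intro z z' hrel hzU
    obtain ⟨R', hR', h⟩ := (mem_statesOf M T).1 hzU
    exact (mem_statesOf M T).2 ⟨R', hR',
      (Quotient.sound ((regionSetoid S Q X T.bMax).symm hrel)).trans h⟩
  have hpat (φ : ℝ → ℝ) (hφ : IsPerturbation (F₁ ∪ F₂) w O φ) : PatternOn φ (F₁ ∪ O) :=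
    hφ.patternOn_union hFfin hw0 hwg hg1 hinj Set.subset_union_left hF₁g hO
  have hact {j : ℕ} (hj : j ≤ n + 1) : activeTimes T.bMax (u j) ⊆ F₁ ∪ O :=
    (activeTimes_subset_of_descentStep hu T.bMax j).trans
      (Set.union_subset_union_left _ (Set.image_mono (Set.Icc_subset_Icc_right hj)))
  -- Induction on the number d of descent steps still to be made. During the descent the pattern is
  -- needed on F₁ and the old times O; at its end all relevant reset times are in F₁, and the path
  -- needs the pattern only on F₁ ∪ F₂.
  have key (d : ℕ) (hd : d ≤ n + 1) : ∀ φ, IsPerturbation (F₁ ∪ F₂) w O φ → ∀ z',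
      StateShadow T.bMax (u (n + 1 - d)).2 φ (u (n + 1 - d)).1 z' →
      ENNReal.ofReal (M.pMin * cδ * w) ^ (d + k) ≤ (M.prodKernel T ^ (d + k)) z' U := by
    induction d with
    | zero =>
      intro φ hφ z' hz'
      rw [zero_add]
      refine hF₂.le_pow hUm hUR hcδ hFfin hw0 (hwg.trans hg1) hw1 hinj hFO Set.subset_union_right
        (.inl ⟨n + 1, by simp, rfl⟩) ?_ hφ hz'
      exact (resetTimes_subset_image_of_descentStep hu h0 hO hn.ge).trans
        ((Set.image_mono (Set.Icc_subset_Icc_right n.le_succ)).trans Set.subset_union_left)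
    | succ d ih =>
      intro φ hφ z' hz'
      specialize ih (by omega)
      obtain ⟨i, hi1, hi2, hi3⟩ : ∃ i, n + 1 - d = i + 1 ∧ n + 1 - (d + 1) = i ∧ i + 1 ≤ n + 1 :=
        ⟨n - d, by omega⟩
      rw [hi1] at ih
      rw [hi2] at hz'
      obtain ⟨s', t, hs', ht, hfr, h, -⟩ := hu i
      have hmem : (u i).2 + t ∈ F₁ := ⟨i + 1, ⟨by omega, hi3⟩, by dsimp only; rw [h]⟩
      rw [h] at ih
      rw [show d + 1 + k = 1 + (d + k) by omega, Kernel.pow_add_apply_eq_lintegral _ _ _ _ hUm,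
        pow_add, pow_one, pow_one]
      exact hcδ.mul_le_lintegral_of_stateShadow hw1 (hact (by omega) (Set.mem_insert _ _))
        ((Set.subset_insert _ _).trans (hact (by omega))) hs' ht hfr (.inl hmem)
        (Good := IsPerturbation (F₁ ∪ F₂) w O) hpat (v := windowLeft (F₁ ∪ F₂) w ((u i).2 + t))
        (fun φ hφ y hy => hφ.update (hFO.notMem_of_mem_left (.inl hmem)) hy)
        ((M.prodKernel T ^ (d + k)).measurable_coe hUm) ih hφ hz'
  obtain ⟨φ, hφ⟩ := exists_isPerturbation hw0 hFO
  refine ⟨n + 1 + k, by omega, key (n + 1) le_rfl φ hφ z ⟨?_, ?_, ?_⟩⟩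
  · rw [Nat.sub_self, hu0]
  · rw [Nat.sub_self, hu0]
  · rw [Nat.sub_self]
    have : z.2.2 = (u 0).1.2.2 := by rw [hu0]
    rw [this]
    exact Shadow.refl (hφ.2 _ (Set.mem_insert _ _))
      fun r hr => hφ.2 _ (Set.mem_insert_of_mem _ hr)

/-! ### The final bound -/

theorem pMin_le_one (M : SMP S) (s : S) : M.pMin ≤ 1 := by
  obtain ⟨s', hs'⟩ := (M.trans s).support_nonempty
  have h := (ofReal_pMin_le M hs').trans ((M.trans s).coe_le_one s')
  exact ENNReal.ofReal_le_one.1 h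

/-- If the mass beyond B is positive, it exceeds cδ and is at most 1. Otherwise a unit interval on
which the density is nonzero lies in [0, B], and the density exceeds cδ on it. -/
theorem IsDelayBound.le_one {B : ℕ} {cδ : ℝ} (hcδ : M.IsDelayBound B cδ) (s : S) : cδ ≤ 1 := by
  have hf := M.isDelayDensity_delay s s
  obtain ⟨h1, h2⟩ := hcδ.2 s s
  have htot {W : Set ℝ} (hW : W ⊆ Set.Ici 0) : ∫⁻ t in W, M.delay s s t ≤ 1 :=
    (lintegral_mono_set hW).trans_eq hf.2.2.1
  refine ENNReal.ofReal_le_one.1 ?_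
  rcases h2 with h2 | h2
  · exact h2.le.trans (htot (Set.Ici_subset_Ici.2 (Nat.cast_nonneg B)))
  · obtain ⟨l, hl⟩ := hf.exists_unit_interval
    have hl0 : (0 : ℝ) ≤ l := Nat.cast_nonneg l
    have hlB : (l : ℝ) + 1 ≤ B := by
      by_contra hcon
      have hBl : B ≤ l := by
        by_contra h
        exact hcon (by exact_mod_cast not_le.1 h)
      have hBl' : (B : ℝ) ≤ l := by exact_mod_cast hBl
      rw [setLIntegral_eq_zero_iff measurableSet_Ici
        (by have := hf.measurable; fun_prop)] at h2
      have h3 : volume (Set.Icc (l : ℝ) (l + 1)) = 0 := by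
        refine measure_mono_null (fun t ht => ?_) (ae_iff.1 h2)
        simp only [Set.mem_ofPred_eq, Classical.not_imp]
        exact ⟨hBl'.trans ht.1, by simpa using hl t ht⟩
      simp at h3
    calc ENNReal.ofReal cδ = ∫⁻ _ in Set.Icc (l : ℝ) (l + 1), ENNReal.ofReal cδ := by
          rw [setLIntegral_const, Real.volume_Icc]
          simp
      _ ≤ ∫⁻ t in Set.Icc (l : ℝ) (l + 1), M.delay s s t :=
          setLIntegral_mono' measurableSet_Icc fun t ht =>
            ENNReal.ofReal_le_of_le_toReal
              ((h1 t ⟨hl0.trans ht.1, ht.2.trans hlB⟩).resolve_right (hl t ht)).le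
      _ ≤ 1 := htot fun t ht => hl0.trans ht.1

theorem pow_le_pow_bottomVertices {s₀ : S} (hinit : M.init = PMF.pure s₀) {cδ : ℝ}
    (hcδ : M.IsDelayBound T.bMax cδ) (R : M.RegionVertex T) {z : ProdState S Q X}
    (hz : regionOf T z = R.1) {c : ℕ} (hc : c = 4 * Nat.card (M.RegionVertex T)) :
    (M.pMin * cδ / c) ^ c ≤
      ((M.prodKernel T ^ c) z).real (M.statesOf T (M.bottomVertices T)) := by
  set n := Nat.card (M.RegionVertex T) with hn
  set U := M.statesOf T (M.bottomVertices T)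
  have hn1 : 1 ≤ n := Nat.one_le_iff_ne_zero.2 (Nat.card_ne_zero.2 ⟨⟨R⟩, inferInstance⟩)
  have hn1' : (1 : ℝ) ≤ n := by exact_mod_cast hn1
  have hUm : MeasurableSet U := measurableSet_statesOf M T _
  obtain ⟨N, hN, hle⟩ := exists_le_pow_bottomVertices hinit hcδ R hz hn
  have hpc0 : 0 ≤ M.pMin * cδ := mul_nonneg M.pMin_nonneg hcδ.1.le
  have hpc1 : M.pMin * cδ ≤ 1 := mul_le_one₀ (M.pMin_le_one s₀) hcδ.1.le (hcδ.le_one s₀)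
  set e := M.pMin * cδ * (1 / (2 * n * (n + 3))) with he
  have he0 : 0 ≤ e := by positivity
  have hw : 1 / (c : ℝ) ^ 2 ≤ 1 / (2 * n * (n + 3)) := by
    refine one_div_le_one_div_of_le (by positivity) ?_
    rw [hc]
    push_cast
    nlinarith
  have he1 : e ≤ 1 := by
    refine mul_le_one₀ hpc1 (by positivity) ?_
    rw [div_le_one (by positivity)]
    nlinarith
  -- One factor p_min c_𝔇 ≤ 1 is given away, so two factors of the final bound pay for one step of
  -- width w. This is why c = 4n suffices for 2n steps.
  have hsq : (M.pMin * cδ / c) ^ 2 ≤ e := by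
    calc (M.pMin * cδ / c) ^ 2 = (M.pMin * cδ) * (M.pMin * cδ * (1 / (c : ℝ) ^ 2)) := by
          rw [div_pow]; ring
      _ ≤ 1 * (M.pMin * cδ * (1 / (c : ℝ) ^ 2)) :=
          mul_le_mul_of_nonneg_right hpc1 (by positivity)
      _ ≤ e := by
          rw [one_mul]
          exact mul_le_mul_of_nonneg_left hw hpc0
  have hmain : (M.pMin * cδ / c) ^ c ≤ e ^ N := by
    calc (M.pMin * cδ / c) ^ c = ((M.pMin * cδ / c) ^ 2) ^ (2 * n) := by
          rw [← pow_mul, hc]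
          congr 1
          ring
      _ ≤ e ^ (2 * n) := pow_le_pow_left₀ (by positivity) hsq _
      _ ≤ e ^ N := pow_le_pow_of_le_one he0 he1 hN
  refine hmain.trans ?_
  have hle' : e ^ N ≤ ((M.prodKernel T ^ N) z).real U := by
    rw [← ENNReal.ofReal_pow he0] at hle
    exact (ENNReal.ofReal_le_iff_le_toReal (measure_ne_top _ _)).1 hle
  refine hle'.trans ?_
  -- The number N of steps depends on the state; closedness of the bottom vertices extends the bound
  -- to the common number c.
  have hcompl := (isClosedUnderEdges_bottomVertices M T).pow_add_compl_le z N (c - N)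
  rw [show N + (c - N) = c by omega] at hcompl
  have h1 := ENNReal.toReal_mono (measure_ne_top _ _) hcompl
  change ((M.prodKernel T ^ c) z).real Uᶜ ≤ ((M.prodKernel T ^ N) z).real Uᶜ at h1
  rw [probReal_compl_eq_one_sub hUm, probReal_compl_eq_one_sub hUm] at h1
  linarith

end SMP

theorem mainTheorem4 {S Q X : Type*}
    [Fintype S] [MeasurableSpace S] [DiscreteMeasurableSpace S]
    [Fintype Q] [MeasurableSpace Q] [DiscreteMeasurableSpace Q] [Fintype X]
    (M : SMP S) (T : DTA Q S X) (s₀ : S) (hinit : M.init = PMF.pure s₀)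
    (C : Set (M.RegionVertex T)) (hC : M.IsBSCC T C)
    (cδ : ℝ) (hcδ : M.IsDelayBound T.bMax cδ)
    (c : ℕ) (hc : c = 4 * Nat.card (M.RegionVertex T)) (i : ℕ) :
    M.runMeasure.real (M.runsReaching T C) -
        ((M.prodKernel T ^ i) (s₀, T.init, 0)).real (M.statesOf T C) ≤
      (1 - (M.pMin * cδ / c) ^ c) ^ (i / c) := by
  have hUm := SMP.measurableSet_statesOf M T (M.bottomVertices T)
  have hz₀ : ∃ R : M.RegionVertex T, regionOf T (s₀, T.init, 0) = R.1 := by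
    refine ⟨⟨regionOf T (s₀, T.init, 0), 0, ?_⟩, rfl⟩
    rw [SMP.prodInit_eq_dirac hinit, Measure.dirac_bind (Kernel.measurable _), pow_zero]
    change 0 < Kernel.id _ _
    rw [Kernel.id_apply, Measure.dirac_apply' _ (measurableSet_states _), Set.indicator_of_mem]
    · simp
    · rfl
  have hz₀' : (s₀, T.init, 0) ∈ M.statesOf T Set.univ :=
    (SMP.mem_statesOf M T).2 (hz₀.imp fun _ h => ⟨trivial, h⟩)
  have hq : ∀ z ∈ M.statesOf T Set.univ,
      (M.prodKernel T ^ c) z (M.statesOf T (M.bottomVertices T))ᶜ ≤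
        ENNReal.ofReal (1 - (M.pMin * cδ / c) ^ c) := by
    intro z hz
    obtain ⟨R, -, hR⟩ := (SMP.mem_statesOf M T).1 hz
    rw [← ofReal_measureReal, probReal_compl_eq_one_sub hUm]
    refine ENNReal.ofReal_le_ofReal ?_
    linarith [SMP.pow_le_pow_bottomVertices hinit hcδ R hR hc]
  have hnonneg : 0 ≤ 1 - (M.pMin * cδ / c) ^ c := by
    obtain ⟨R, hR⟩ := hz₀
    have := SMP.pow_le_pow_bottomVertices hinit hcδ R hR hc
    have h1 : ((M.prodKernel T ^ c) (s₀, T.init, 0)).real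
      (M.statesOf T (M.bottomVertices T)) ≤ 1 := measureReal_le_one
    linarith
  refine (hC.runMeasure_sub_le hinit i).trans ?_
  have := (SMP.isClosedUnderEdges_bottomVertices M T).pow_compl_le hz₀' hq i
  rw [← ENNReal.ofReal_pow hnonneg] at this
  exact ENNReal.toReal_le_of_le_ofReal (pow_nonneg hnonneg _) this
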